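/- Let $0=\tau_0<\tau_1<\dots<\tau_N=\tau$ and, for $n=1,\dots,N$, let $\mu^{(n)}\in\mathbb R^K$, $\sigma^{(n)}\in[0,\infty)^K$ and let $A^{(n)}\in\mathbb R^{K\times K}$ be a generator matrix, i.e. $A^{(n)}_{ij}\ge 0$ for $i\ne j$ and $\sum_{j}A^{(n)}_{ij}=0$ for all $i$. On a probability space with measure $\mathbb Q$ and a filtration $(\mathcal F_t)_{t\ge0}$, let $W$ be an $(\mathcal F_t)$-Brownian motion, and let $Z$ be a right-continuous $(\mathcal F_t)$-Markov chain in continuous time with values in $\{1,\dots,K\}$ whose generator matrix is $A^{(n)}$ on $[\tau_{n-1},\tau_n)$, $n=1,\dots,N$. Let $X$ satisfy $X_0=0$ and $$dX_t=\Big(\mu^{(n)}_{Z_t}-\tfrac12\big(\sigma^{(n)}_{Z_t}\big)^2\Big)\,dt+\sigma^{(n)}_{Z_t}\,dW_t,\qquad t\in[\tau_{n-1},\tau_n),\quad n=1,\dots,N,$$ the last term being an Itô integral. Then, for every real (and, more generally, every complex) $\omega$, the random variable $e^{i\omega X_\tau}$ is integrable and the characteristic function of $X_\tau$ is $$\mathbb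 E^{\mathbb Q}\big[e^{i\omega X_\tau}\big]=\boldsymbol\pi^{\intercal}\,e^{\tau_1\Psi^{(1)}(\omega)}\,e^{(\tau_2-\tau_1)\Psi^{(2)}(\omega)}\cdots e^{(\tau-\tau_{N-1})\Psi^{(N)}(\omega)}\,\boldsymbol 1,$$ where $\pi_k=\mathbb Q(Z_0=k)$, $\boldsymbol 1=(1,\dots,1)^{\intercal}\in\mathbb R^K$, and $$\big[\Psi^{(n)}(\omega)\big]_{jk}=\Big(A^{(n)}_{kk}+i\big(\mu^{(n)}_k-\tfrac12(\sigma^{(n)}_k)^2\big)\omega-\tfrac12(\sigma^{(n)}_k)^2\omega^2\Big)\delta_{jk}+A^{(n)}_{jk}(1-\delta_{jk}).$$ -/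

import Mathlib

open MeasureTheory ProbabilityTheory Filter Topology
open scoped NNReal ENNReal

namespace RegimeSwitching

/-- A generator (transition rate) matrix on `{1, …, K}`: nonnegative off the diagonal, with
vanishing row sums. -/
structure IsGenerator {K : ℕ} (A : Matrix (Fin K) (Fin K) ℝ) : Prop where
  nonneg_off_diag : ∀ i j, i ≠ j → 0 ≤ A i j
  row_sum : ∀ i, ∑ j, A i j = 0

/-- `W` is a (standard, one-dimensional) Brownian motion relative to the filtration `F`: a Brownian
motion that is adapted to `F` and whose increments after time `s` are independent of `F s`. -/
structure IsBrownianRel {Ω : Type*} {mΩ : MeasurableSpace Ω} (F : Filtration ℝ≥0 mΩ)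
    (Q : Measure Ω) (W : ℝ≥0 → Ω → ℝ) : Prop where
  isBrownian : IsBrownianReal W Q
  adapted : ∀ t, Measurable[F t] (W t)
  indep_increment : ∀ s t, s ≤ t →
    Indep (MeasurableSpace.comap (fun x => W t x - W s x) inferInstance) (F s) Q

/-- `Z` is, on `[0, τ_N]`, a continuous time Markov chain relative to the filtration `F`, with
states `{1, …, K}` and with the generator matrix `A n` on the period `[τ_n, τ_{n+1})`,
`n = 0, …, N - 1`: it is adapted, has almost surely right-continuous paths, has the Markov
property, and its transition probabilities satisfy
`ℙ(Z_t = j | Z_s = i) = δ_ij + A_ij (t - s) + o(t - s)` as `t - s ↓ 0`,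
uniformly for `s ≤ t` in the period. -/
structure IsMarkovChain {Ω : Type*} {mΩ : MeasurableSpace Ω} (F : Filtration ℝ≥0 mΩ)
    (Q : Measure Ω) {N K : ℕ} (τ : Fin (N + 1) → ℝ≥0)
    (A : Fin N → Matrix (Fin K) (Fin K) ℝ) (Z : ℝ≥0 → Ω → Fin K) : Prop where
  adapted : ∀ t, t ≤ τ (Fin.last N) → Measurable[F t] (Z t)
  right_continuous : ∀ᵐ x ∂Q, ∀ t, t < τ (Fin.last N) →
    ContinuousWithinAt (fun s => Z s x) (Set.Ici t) t
  markov : ∀ s t, s ≤ t → t ≤ τ (Fin.last N) → ∀ j,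
    Q[{x | Z t x = j}.indicator (fun _ => (1 : ℝ)) | F s]
      =ᵐ[Q] Q[{x | Z t x = j}.indicator (fun _ => (1 : ℝ)) |
        MeasurableSpace.comap (Z s) inferInstance]
  rates : ∀ n i j, ∀ ε : ℝ, 0 < ε → ∃ δ : ℝ, 0 < δ ∧ ∀ s t : ℝ≥0,
    τ n.castSucc ≤ s → s ≤ t → t ≤ τ n.succ → (t : ℝ) - s < δ →
      |Q.real {x | Z s x = i ∧ Z t x = j}
          - Q.real {x | Z s x = i} * ((if i = j then 1 else 0) + ((t : ℝ) - s) * A n i j)|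
        ≤ ε * ((t : ℝ) - s) * Q.real {x | Z s x = i}

/-- A simple (elementary) integrand on `[a, b]`: for times `a = t_0 ≤ t_1 ≤ … ≤ t_m = b`, it takes
the value `ξ_i`, bounded and `F t_i`-measurable, on `(t_i, t_{i+1}]`. -/
structure SimpleIntegrand {Ω : Type*} {mΩ : MeasurableSpace Ω} (F : Filtration ℝ≥0 mΩ)
    (a b : ℝ≥0) where
  size : ℕ
  time : Fin (size + 1) → ℝ≥0
  time_mono : Monotone time
  time_zero : time 0 = a
  time_last : time (Fin.last size) = b
  coeff : Fin size → Ω → ℝ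
  coeff_measurable : ∀ i, Measurable[F (time i.castSucc)] (coeff i)
  coeff_bounded : ∃ C : ℝ, ∀ i x, |coeff i x| ≤ C

/-- The value `∑ i, ξ_i 1_{(t_i, t_{i+1}]}(s)` of a simple integrand at time `s`. -/
noncomputable def SimpleIntegrand.value {Ω : Type*} {mΩ : MeasurableSpace Ω}
    {F : Filtration ℝ≥0 mΩ} {a b : ℝ≥0} (V : SimpleIntegrand F a b) (s : ℝ≥0) (x : Ω) : ℝ :=
  ∑ i : Fin V.size,
    (Set.Ioc (V.time i.castSucc) (V.time i.succ)).indicator (fun _ => V.coeff i x) s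

/-- The stochastic integral `∑ i, ξ_i (W_{t_{i+1}} - W_{t_i})` of a simple integrand. -/
noncomputable def SimpleIntegrand.integral {Ω : Type*} {mΩ : MeasurableSpace Ω}
    {F : Filtration ℝ≥0 mΩ} {a b : ℝ≥0} (V : SimpleIntegrand F a b)
    (W : ℝ≥0 → Ω → ℝ) (x : Ω) : ℝ :=
  ∑ i : Fin V.size, V.coeff i x * (W (V.time i.succ) x - W (V.time i.castSucc) x)

/-- `J` is (a version of) the Itô integral `∫_a^b H_s dW_s`: it is the `L²` limit of the stochastic
integrals of simple integrands `V n` with `𝔼 ∫_a^b (V n - H)² ds → 0`. -/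
def IsItoIntegral {Ω : Type*} {mΩ : MeasurableSpace Ω} (F : Filtration ℝ≥0 mΩ) (Q : Measure Ω)
    (W H : ℝ≥0 → Ω → ℝ) (a b : ℝ≥0) (J : Ω → ℝ) : Prop :=
  MemLp J 2 Q ∧ ∃ V : ℕ → SimpleIntegrand F a b,
    Tendsto (fun n => ∫⁻ x, (∫⁻ s in Set.Icc (a : ℝ) b,
      ENNReal.ofReal (((V n).value s.toNNReal x - H s.toNNReal x) ^ 2)) ∂Q) atTop (𝓝 0) ∧
    Tendsto (fun n => eLpNorm (fun x => (V n).integral W x - J x) 2 Q) atTop (𝓝 0)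

/-- `X` starts at `0` and satisfies, on `[0, τ_N]`, the stochastic differential equation
`dX_t = (μ_{Z_t} - σ_{Z_t}² / 2) dt + σ_{Z_t} dW_t` with the drifts `μ n` and the volatilities `σ n`
on the period `[τ_n, τ_{n+1})`, `n = 0, …, N - 1`. -/
structure IsLogReturn {Ω : Type*} {mΩ : MeasurableSpace Ω} (F : Filtration ℝ≥0 mΩ)
    (Q : Measure Ω) {N K : ℕ} (τ : Fin (N + 1) → ℝ≥0) (μ σ : Fin N → Fin K → ℝ)
    (Z : ℝ≥0 → Ω → Fin K) (W X : ℝ≥0 → Ω → ℝ) : Prop where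
  init : ∀ᵐ x ∂Q, X 0 x = 0
  sde : ∀ n : Fin N, ∀ t : ℝ≥0, τ n.castSucc ≤ t → t ≤ τ n.succ →
    ∃ J : Ω → ℝ, IsItoIntegral F Q W (fun s x => σ n (Z s x)) (τ n.castSucc) t J ∧
      ∀ᵐ x ∂Q, X t x = X (τ n.castSucc) x
        + (∫ s in (τ n.castSucc : ℝ)..t,
            (μ n (Z s.toNNReal x) - 1 / 2 * σ n (Z s.toNNReal x) ^ 2))
        + J x

/-- The matrix `Ψ(ω)` of one period: its diagonal entries are
`A_kk + i (μ_k - σ_k² / 2) ω - σ_k² ω² / 2`, its off-diagonal entries those of `A`. -/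
noncomputable def Psi {K : ℕ} (A : Matrix (Fin K) (Fin K) ℝ) (μ σ : Fin K → ℝ) (ω : ℂ) :
    Matrix (Fin K) (Fin K) ℂ :=
  Matrix.of fun j k =>
    if j = k then
      (A k k : ℂ) + Complex.I * ((μ k : ℂ) - 1 / 2 * (σ k : ℂ) ^ 2) * ω
        - 1 / 2 * (σ k : ℂ) ^ 2 * ω ^ 2
    else (A j k : ℂ)

end RegimeSwitching

/-!
The characteristic function is computed along an Euler scheme in which the regime is frozen on each
step of a fine grid. For the weight `Y = exp (z X)`, `z = i ω`, accumulated up to time `s`, the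
vector `j ↦ 𝔼[Y; Z_s = j]` is followed over one step of length `h`. To first order in `h` it is
multiplied by `1 + h Ψ`: staying in regime `i` contributes the Gaussian moment generating function,
a jump contributes the rate `A i j`.

The chain and the Brownian motion are not assumed independent; they only share a filtration.
What decouples them is that a jump within one step has probability `O(h)` while, by
Brownian scaling, the fourth moment of `exp (z (c h + σ ΔW)) - 1` is `O(h²)`; by a Young inequality
the Gaussian factor on a jump can be replaced by `1` with an error `o(h)`
(`IsMarkovChain.setIntegral_jump`). The weight on staying in `i` is then the total, where the
increment is independent of the past, minus the jumps (`IsMarkovChain.setIntegral_step`). Adding up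
the local errors along the semigroup `exp (t Ψ)` gives the transform over a period in the limit of
vanishing mesh (`IsMarkovChain.setIntegral_period`).

It remains to see that the scheme converges to `X` strongly enough. Since the regime rarely jumps
in a short time, the frozen coefficients converge to the true ones in `L²(Q × ds)`
(`IsMarkovChain.tendsto_frozen`), and the Itô isometry, proved for elementary processes with
arbitrary time grids (`IsBrownianRel.eLpNorm_stepIntegral_sub`), turns this into `L²` convergence of
the stochastic integrals (`tendsto_eulerSum`). Exponential moments of the scheme of every order are
bounded uniformly in the mesh, so the transforms converge (`tendsto_integral_exp`) and `exp (z X)`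
is integrable, by Fatou's lemma.
-/

namespace RegimeSwitching

/-! ### Brownian increments and the Itô isometry -/

section Brownian

variable {Ω : Type*} {mΩ : MeasurableSpace Ω} {Q : Measure Ω} {F : Filtration ℝ≥0 mΩ}
  {W : ℝ≥0 → Ω → ℝ}

lemma IsBrownianRel.measurable (hW : IsBrownianRel F Q W) (t : ℝ≥0) : Measurable (W t) :=
  (hW.adapted t).mono (F.le t) le_rfl

lemma IsBrownianRel.measurable_sub (hW : IsBrownianRel F Q W) {s t r : ℝ≥0} (hs : s ≤ r)
    (ht : t ≤ r) : Measurable[F r] (fun x => W t x - W s x) :=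
  ((hW.adapted t).mono (F.mono ht) le_rfl).sub ((hW.adapted s).mono (F.mono hs) le_rfl)

lemma IsBrownianRel.hasLaw_increment (hW : IsBrownianRel F Q W) {s t : ℝ≥0} (hst : s ≤ t) :
    HasLaw (fun x => W t x - W s x) (gaussianReal 0 (t - s)) Q := by
  have h := hW.isBrownian.toIsPreBrownianReal.hasLaw_sub t s
  have e : nndist (t : ℝ) (s : ℝ) = t - s := by
    ext
    rw [coe_nndist, Real.dist_eq, NNReal.coe_sub hst, abs_of_nonneg]
    exact sub_nonneg.2 (by exact_mod_cast hst)
  exact e ▸ h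

lemma IsBrownianRel.indepFun_increment (hW : IsBrownianRel F Q W) {s t : ℝ≥0} (hst : s ≤ t)
    {β : Type*} [MeasurableSpace β] {Y : Ω → β} (hY : Measurable[F s] Y) :
    IndepFun Y (fun x => W t x - W s x) Q :=
  (IndepFun_iff_Indep _ _ _).2
    (indep_of_indep_of_le_left (hW.indep_increment s t hst).symm hY.comap_le)

lemma IsBrownianRel.memLp_increment (hW : IsBrownianRel F Q W) {s t : ℝ≥0} (hst : s ≤ t) :
    MemLp (fun x => W t x - W s x) 2 Q := by
  have h := hW.hasLaw_increment hst
  have h2 : MemLp id 2 (Measure.map (fun x => W t x - W s x) Q) := by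
    rw [h.map_eq]; exact memLp_id_gaussianReal' 2 (by simp)
  exact (memLp_map_measure_iff h2.1 h.aemeasurable).1 h2

lemma IsBrownianRel.integral_mul_increment (hW : IsBrownianRel F Q W) {s t : ℝ≥0} (hst : s ≤ t)
    {g : Ω → ℝ} (hg : Measurable[F s] g) : ∫ x, g x * (W t x - W s x) ∂Q = 0 := by
  have h := (hW.indepFun_increment hst hg).integral_mul_eq_mul_integral
    (hg.mono (F.le s) le_rfl).aestronglyMeasurable
    ((hW.measurable t).sub (hW.measurable s)).aestronglyMeasurable
  simp only [Pi.mul_apply] at h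
  rw [h, (hW.hasLaw_increment hst).integral_eq, integral_id_gaussianReal, mul_zero]

lemma IsBrownianRel.integral_mul_increment_sq (hW : IsBrownianRel F Q W) {s t : ℝ≥0}
    (hst : s ≤ t) {g : Ω → ℝ} (hg : Measurable[F s] g) :
    ∫ x, g x * (W t x - W s x) ^ 2 ∂Q = (∫ x, g x ∂Q) * ((t - s : ℝ≥0) : ℝ) := by
  have hm : Measurable (fun x => W t x - W s x) := (hW.measurable t).sub (hW.measurable s)
  have h := ((hW.indepFun_increment hst hg).comp measurable_id
    (measurable_id.pow_const 2 : Measurable fun y : ℝ => y ^ 2)).integral_mul_eq_mul_integral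
    (hg.mono (F.le s) le_rfl).aestronglyMeasurable (hm.pow_const 2).aestronglyMeasurable
  simp only [Pi.mul_apply, Function.comp_apply, id] at h
  have hl := hW.hasLaw_increment hst
  have hv := hl.variance_eq
  rw [variance_id_gaussianReal, variance_of_integral_eq_zero hm.aemeasurable] at hv
  · rw [h, hv]
  · rw [hl.integral_eq, integral_id_gaussianReal]

/-- The martingale covariance of two elementary stochastic integrals: each increment is scaled by
a coefficient known at its left end, and only the overlap of the two time intervals counts. -/
lemma IsBrownianRel.integral_mul_increments (hW : IsBrownianRel F Q W) {s t u v : ℝ≥0}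
    (hst : s ≤ t) (huv : u ≤ v) {ξ η : Ω → ℝ} (hξ : Measurable[F s] ξ) (hη : Measurable[F u] η)
    {C : ℝ} (hξC : ∀ x, |ξ x| ≤ C) (hηC : ∀ x, |η x| ≤ C) :
    ∫ x, (ξ x * (W t x - W s x)) * (η x * (W v x - W u x)) ∂Q
      = (∫ x, ξ x * η x ∂Q) * ((min t v - max s u : ℝ≥0) : ℝ) := by
  wlog hsu : s ≤ u generalizing s t u v ξ η
  · have := this huv hst hη hξ hηC hξC (le_of_not_ge hsu)
    rw [min_comm, max_comm]
    simp only [mul_comm (η _)] at this ⊢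
    simp only [mul_comm (ξ _)] at this ⊢
    rw [← this]
    congr 1; ext x; ring
  rw [max_eq_right hsu]
  have hξu : Measurable[F u] ξ := hξ.mono (F.mono hsu) le_rfl
  have hξη : Measurable[F u] fun x => ξ x * η x := hξu.mul hη
  -- products of a bounded coefficient and two increments are integrable
  have hint : ∀ {p q p' q' : ℝ≥0}, p ≤ q → p' ≤ q' →
      Integrable (fun x => (ξ x * η x) * ((W q x - W p x) * (W q' x - W p' x))) Q := by
    intro p q p' q' h h'
    refine ((hW.memLp_increment h).integrable_mul (hW.memLp_increment h')).bdd_mul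
      (c := C * C) ?_ (Eventually.of_forall fun x => ?_)
    · exact (hξη.mono (F.le u) le_rfl).aestronglyMeasurable
    · rw [Real.norm_eq_abs, abs_mul]
      exact mul_le_mul (hξC x) (hηC x) (abs_nonneg _) ((abs_nonneg _).trans (hξC x))
  have hzero : ∀ {p q r : ℝ≥0}, p ≤ r → q ≤ r → u ≤ r → ∀ {q'}, r ≤ q' →
      ∫ x, (ξ x * η x) * ((W q x - W p x) * (W q' x - W r x)) ∂Q = 0 := by
    intro p q r hp hq hu q' hq'
    have := hW.integral_mul_increment hq'
      (g := fun x => (ξ x * η x) * (W q x - W p x))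
      ((hξη.mono (F.mono hu) le_rfl).mul (hW.measurable_sub hp hq))
    simpa only [mul_assoc] using this
  have hre : ∀ x, (ξ x * (W t x - W s x)) * (η x * (W v x - W u x))
      = (ξ x * η x) * ((W t x - W s x) * (W v x - W u x)) := fun x => by ring
  simp only [hre]
  rcases le_total t u with htu | hut
  · rw [hzero hsu htu le_rfl huv,
      tsub_eq_zero_of_le ((min_le_left _ _).trans htu)]
    simp
  rcases le_total t v with htv | hvt
  · have e : ∀ x, (ξ x * η x) * ((W t x - W s x) * (W v x - W u x))
        = (ξ x * η x) * ((W t x - W s x) * (W v x - W t x))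
          + (ξ x * η x) * ((W u x - W s x) * (W t x - W u x))
          + (ξ x * η x) * ((W t x - W u x) * (W t x - W u x)) := fun x => by ring
    simp only [e]
    rw [integral_add (by exact (hint hst htv).add (hint hsu hut)) (hint hut hut),
      integral_add (hint hst htv) (hint hsu hut), hzero hst le_rfl hut htv,
      hzero hsu le_rfl le_rfl hut, min_eq_left htv]
    simp only [← pow_two]
    rw [hW.integral_mul_increment_sq hut hξη]
    simp
  · have e : ∀ x, (ξ x * η x) * ((W t x - W s x) * (W v x - W u x))
        = (ξ x * η x) * ((W v x - W u x) * (W t x - W v x))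
          + (ξ x * η x) * ((W u x - W s x) * (W v x - W u x))
          + (ξ x * η x) * ((W v x - W u x) * (W v x - W u x)) := fun x => by ring
    simp only [e]
    rw [integral_add (by exact (hint huv hvt).add (hint hsu huv)) (hint huv huv),
      integral_add (hint huv hvt) (hint hsu huv), hzero huv le_rfl huv hvt,
      hzero hsu le_rfl le_rfl huv, min_eq_right hvt]
    simp only [← pow_two]
    rw [hW.integral_mul_increment_sq huv hξη]
    simp

/-- Time-space measure `Q × ds` on `Ω × [a, b]`, the reference measure for integrands. -/
noncomputable def spaceTime (Q : Measure Ω) (a b : ℝ≥0) : Measure (Ω × ℝ) :=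
  Q.prod (volume.restrict (Set.Icc (a : ℝ) b))

instance [IsFiniteMeasure Q] (a b : ℝ≥0) : IsFiniteMeasure (spaceTime Q a b) := by
  unfold spaceTime; infer_instance

/-- The elementary process `∑ i, ξ i 1_{(s i, t i]}` at a point of `Ω × ℝ`. -/
noncomputable def stepProcess {ι : Type*} [Fintype ι] (s t : ι → ℝ≥0) (ξ : ι → Ω → ℝ)
    (p : Ω × ℝ) : ℝ :=
  ∑ i, (Set.Ioc (s i) (t i)).indicator (fun _ => ξ i p.1) p.2.toNNReal

/-- The stochastic integral `∑ i, ξ i (W (t i) - W (s i))` of an elementary process. -/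
def stepIntegral {ι : Type*} [Fintype ι] (W : ℝ≥0 → Ω → ℝ) (s t : ι → ℝ≥0) (ξ : ι → Ω → ℝ)
    (x : Ω) : ℝ :=
  ∑ i, ξ i x * (W (t i) x - W (s i) x)

lemma measurable_stepProcess {ι : Type*} [Fintype ι] {s t : ι → ℝ≥0} {ξ : ι → Ω → ℝ}
    (hξ : ∀ i, Measurable (ξ i)) : Measurable (stepProcess s t ξ) := by
  unfold stepProcess
  refine Finset.measurable_sum _ fun i _ => ?_
  have : (fun p : Ω × ℝ => (Set.Ioc (s i) (t i)).indicator (fun _ => ξ i p.1) p.2.toNNReal)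
      = ((fun p : Ω × ℝ => p.2.toNNReal) ⁻¹' Set.Ioc (s i) (t i)).indicator
        (fun p => ξ i p.1) := by
    ext p; simp [Set.indicator]
  rw [this]
  exact ((hξ i).comp measurable_fst).indicator
    ((measurable_real_toNNReal.comp measurable_snd) measurableSet_Ioc)

lemma setIntegral_indicator_Ioc_mul {a b s t u v : ℝ≥0} (has : a ≤ s) (htb : t ≤ b) :
    ∫ r in Set.Icc (a : ℝ) b, ((Set.Ioc s t).indicator (fun _ => (1 : ℝ)) r.toNNReal)
      * ((Set.Ioc u v).indicator (fun _ => (1 : ℝ)) r.toNNReal)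
      = ((min t v - max s u : ℝ≥0) : ℝ) := by
  have e : ∀ r ∈ Set.Icc (a : ℝ) b, ((Set.Ioc s t).indicator (fun _ => (1 : ℝ)) r.toNNReal)
      * ((Set.Ioc u v).indicator (fun _ => (1 : ℝ)) r.toNNReal)
      = (Set.Ioc ((max s u : ℝ≥0) : ℝ) (min t v : ℝ≥0)).indicator 1 r := by
    intro r hr
    have hr0 : (0 : ℝ) ≤ r := a.2.trans hr.1
    lift r to ℝ≥0 using hr0
    rw [Real.toNNReal_coe]
    simp only [Set.indicator, Set.mem_Ioc, Pi.one_apply, NNReal.coe_lt_coe, NNReal.coe_le_coe,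
      max_lt_iff, le_min_iff]
    split_ifs <;> grind
  rw [setIntegral_congr_fun measurableSet_Icc e, integral_indicator_one measurableSet_Ioc,
    Measure.real, Measure.restrict_apply measurableSet_Ioc, Set.inter_eq_left.2]
  · rw [Real.volume_Ioc, ENNReal.toReal_ofReal', ← NNReal.coe_zero]
    rw [NNReal.coe_sub_def, NNReal.coe_zero]
  · intro r hr
    have h1 : (a : ℝ) ≤ (max s u : ℝ≥0) := by exact_mod_cast has.trans (le_max_left _ _)
    have h2 : ((min t v : ℝ≥0) : ℝ) ≤ b := by exact_mod_cast (min_le_left _ _).trans htb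
    exact ⟨h1.trans hr.1.le, hr.2.trans h2⟩

/-- The **Itô isometry** for elementary processes, whose time intervals may overlap. -/
theorem IsBrownianRel.integral_stepIntegral_sq [IsFiniteMeasure Q] (hW : IsBrownianRel F Q W)
    {ι : Type*} [Fintype ι] {s t : ι → ℝ≥0} {ξ : ι → Ω → ℝ} {a b : ℝ≥0} {C : ℝ}
    (hst : ∀ i, s i ≤ t i) (has : ∀ i, a ≤ s i) (htb : ∀ i, t i ≤ b)
    (hξ : ∀ i, Measurable[F (s i)] (ξ i)) (hC : ∀ i x, |ξ i x| ≤ C) :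
    ∫ x, stepIntegral W s t ξ x ^ 2 ∂Q = ∫ p, stepProcess s t ξ p ^ 2 ∂(spaceTime Q a b) := by
  have hξ' : ∀ i, Measurable (ξ i) := fun i => (hξ i).mono (F.le _) le_rfl
  have hbdd : ∀ i, MemLp (ξ i) ∞ Q := fun i =>
    memLp_top_of_bound (hξ' i).aestronglyMeasurable C (Eventually.of_forall (hC i))
  have hL : ∀ i, MemLp (fun x => ξ i x * (W (t i) x - W (s i) x)) 2 Q := fun i =>
    (hW.memLp_increment (hst i)).mul (hbdd i)
  have hLL : ∀ i j, Integrable (fun x => (ξ i x * (W (t i) x - W (s i) x)) *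
      (ξ j x * (W (t j) x - W (s j) x))) Q := fun i j => (hL i).integrable_mul (hL j)
  have h1 : ∀ x, stepIntegral W s t ξ x ^ 2 = ∑ i, ∑ j,
      (ξ i x * (W (t i) x - W (s i) x)) * (ξ j x * (W (t j) x - W (s j) x)) := by
    intro x; rw [stepIntegral, pow_two, Finset.sum_mul_sum]
  have h2 : ∀ p : Ω × ℝ, stepProcess s t ξ p ^ 2 = ∑ i, ∑ j, (ξ i p.1 * ξ j p.1) *
      (((Set.Ioc (s i) (t i)).indicator (fun _ => (1 : ℝ)) p.2.toNNReal)
      * ((Set.Ioc (s j) (t j)).indicator (fun _ => (1 : ℝ)) p.2.toNNReal)) := by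
    intro p; rw [stepProcess, pow_two, Finset.sum_mul_sum]
    refine Finset.sum_congr rfl fun i _ => Finset.sum_congr rfl fun j _ => ?_
    simp only [Set.indicator]
    split_ifs <;> ring
  simp only [h1, h2]
  rw [integral_finsetSum _ fun i _ => integrable_finsetSum _ fun j _ => hLL i j]
  have hmeas : ∀ i : ι, Measurable fun r : ℝ =>
      (Set.Ioc (s i) (t i)).indicator (fun _ => (1 : ℝ)) r.toNNReal := fun i =>
    (measurable_const.indicator measurableSet_Ioc).comp measurable_real_toNNReal
  have hind : ∀ i j, Integrable (fun p : Ω × ℝ => (ξ i p.1 * ξ j p.1) *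
      (((Set.Ioc (s i) (t i)).indicator (fun _ => (1 : ℝ)) p.2.toNNReal)
      * ((Set.Ioc (s j) (t j)).indicator (fun _ => (1 : ℝ)) p.2.toNNReal))) (spaceTime Q a b) := by
    intro i j
    refine Integrable.mul_prod (f := fun x => ξ i x * ξ j x)
      (g := fun r : ℝ => ((Set.Ioc (s i) (t i)).indicator (fun _ => (1 : ℝ)) r.toNNReal)
      * ((Set.Ioc (s j) (t j)).indicator (fun _ => (1 : ℝ)) r.toNNReal)) ?_ ?_
    · exact memLp_one_iff_integrable.1 (((hbdd j).mul (r := ∞) (hbdd i)).mono_exponent le_top)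
    · refine Integrable.of_bound ((hmeas i).mul (hmeas j)).aestronglyMeasurable 1
        (Eventually.of_forall fun r => ?_)
      simp only [Set.indicator]
      split_ifs <;> simp
  rw [integral_finsetSum _ fun i _ => integrable_finsetSum _ fun j _ => hind i j]
  refine Finset.sum_congr rfl fun i _ => ?_
  rw [integral_finsetSum _ fun j _ => hLL i j, integral_finsetSum _ fun j _ => hind i j]
  refine Finset.sum_congr rfl fun j _ => ?_
  rw [hW.integral_mul_increments (hst i) (hst j) (hξ i) (hξ j) (hC i) (hC j), spaceTime,
    integral_prod_mul (fun x => ξ i x * ξ j x)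
      (fun r : ℝ => ((Set.Ioc (s i) (t i)).indicator (fun _ => (1 : ℝ)) r.toNNReal)
      * ((Set.Ioc (s j) (t j)).indicator (fun _ => (1 : ℝ)) r.toNNReal)),
    setIntegral_indicator_Ioc_mul (has i) (htb i)]

lemma eLpNorm_two_eq_of_integral_sq_eq {α β : Type*} {mα : MeasurableSpace α}
    {mβ : MeasurableSpace β} {μ : Measure α} {ν : Measure β} {f : α → ℝ} {g : β → ℝ}
    (hf : MemLp f 2 μ) (hg : MemLp g 2 ν) (h : ∫ x, f x ^ 2 ∂μ = ∫ y, g y ^ 2 ∂ν) :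
    eLpNorm f 2 μ = eLpNorm g 2 ν := by
  rw [hf.eLpNorm_eq_integral_rpow_norm (by simp) (by simp),
    hg.eLpNorm_eq_integral_rpow_norm (by simp) (by simp)]
  simpa using by rw [h]

theorem IsBrownianRel.eLpNorm_stepIntegral [IsFiniteMeasure Q] (hW : IsBrownianRel F Q W)
    {ι : Type*} [Fintype ι] {s t : ι → ℝ≥0} {ξ : ι → Ω → ℝ} {a b : ℝ≥0} {C : ℝ}
    (hst : ∀ i, s i ≤ t i) (has : ∀ i, a ≤ s i) (htb : ∀ i, t i ≤ b)
    (hξ : ∀ i, Measurable[F (s i)] (ξ i)) (hC : ∀ i x, |ξ i x| ≤ C) :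
    eLpNorm (stepIntegral W s t ξ) 2 Q = eLpNorm (stepProcess s t ξ) 2 (spaceTime Q a b) := by
  have hξ' : ∀ i, Measurable (ξ i) := fun i => (hξ i).mono (F.le _) le_rfl
  refine eLpNorm_two_eq_of_integral_sq_eq ?_ ?_
    (hW.integral_stepIntegral_sq hst has htb hξ hC)
  · refine memLp_finsetSum _ fun i _ => (hW.memLp_increment (hst i)).mul (q := 2) (p := ∞)
      (memLp_top_of_bound (hξ' i).aestronglyMeasurable C (Eventually.of_forall (hC i)))
  · refine MemLp.of_bound (measurable_stepProcess hξ').aestronglyMeasurable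
      (Fintype.card ι • C) (Eventually.of_forall fun p => ?_)
    rw [stepProcess, ← Finset.card_univ, ← Finset.sum_const]
    refine norm_sum_le_of_le _ fun i _ => ?_
    exact (norm_indicator_le_norm_self _ _).trans (hC i p.1)

/-- The isometry applied to the difference of two elementary processes with unrelated time grids. -/
theorem IsBrownianRel.eLpNorm_stepIntegral_sub [IsFiniteMeasure Q] (hW : IsBrownianRel F Q W)
    {ι κ : Type*} [Fintype ι] [Fintype κ] {s t : ι → ℝ≥0} {ξ : ι → Ω → ℝ} {s' t' : κ → ℝ≥0}
    {ξ' : κ → Ω → ℝ} {a b : ℝ≥0} {C C' : ℝ}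
    (hst : ∀ i, s i ≤ t i) (has : ∀ i, a ≤ s i) (htb : ∀ i, t i ≤ b)
    (hξ : ∀ i, Measurable[F (s i)] (ξ i)) (hC : ∀ i x, |ξ i x| ≤ C)
    (hst' : ∀ i, s' i ≤ t' i) (has' : ∀ i, a ≤ s' i) (htb' : ∀ i, t' i ≤ b)
    (hξ' : ∀ i, Measurable[F (s' i)] (ξ' i)) (hC' : ∀ i x, |ξ' i x| ≤ C') :
    eLpNorm (stepIntegral W s t ξ - stepIntegral W s' t' ξ') 2 Q
      = eLpNorm (stepProcess s t ξ - stepProcess s' t' ξ') 2 (spaceTime Q a b) := by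
  have h := hW.eLpNorm_stepIntegral (s := Sum.elim s s') (t := Sum.elim t t')
    (ξ := Sum.elim ξ fun i x => -ξ' i x) (a := a) (b := b) (C := max C C')
    (by rintro (i | i) <;> simp [hst, hst']) (by rintro (i | i) <;> simp [has, has'])
    (by rintro (i | i) <;> simp [htb, htb'])
    (by rintro (i | i); exacts [hξ i, (hξ' i).neg])
    (by rintro (i | i) x
        · exact (hC i x).trans (le_max_left _ _)
        · simpa using (hC' i x).trans (le_max_right _ _))
  convert h using 2
  · ext x
    simp [stepIntegral, sub_eq_add_neg]
  · ext p
    simp [stepProcess, sub_eq_add_neg, Set.indicator_neg]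

end Brownian

/-! ### Euler sums converge to the solution of the stochastic differential equation -/

section Euler

variable {Ω : Type*} {mΩ : MeasurableSpace Ω} {Q : Measure Ω} {F : Filtration ℝ≥0 mΩ}
  {W : ℝ≥0 → Ω → ℝ}

lemma eLpNorm_two_eq_lintegral {α : Type*} {mα : MeasurableSpace α} (μ : Measure α) (f : α → ℝ) :
    eLpNorm f 2 μ = (∫⁻ x, ENNReal.ofReal (f x ^ 2) ∂μ) ^ (2 : ℝ)⁻¹ := by
  rw [eLpNorm_eq_lintegral_rpow_enorm_toReal (by simp) (by simp)]
  simp only [ENNReal.toReal_ofNat, one_div]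
  congr 1
  refine lintegral_congr fun x => ?_
  rw [← sq_abs, ← Real.norm_eq_abs, ENNReal.ofReal_pow (norm_nonneg _), ofReal_norm]
  norm_cast

lemma eLpNorm_spaceTime [SFinite Q] {a b : ℝ≥0} {f : Ω × ℝ → ℝ}
    (hf : AEMeasurable f (spaceTime Q a b)) :
    eLpNorm f 2 (spaceTime Q a b)
      = (∫⁻ x, (∫⁻ s in Set.Icc (a : ℝ) b, ENNReal.ofReal (f (x, s) ^ 2)) ∂Q) ^ (2 : ℝ)⁻¹ := by
  rw [eLpNorm_two_eq_lintegral, spaceTime, lintegral_prod]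
  exact (hf.pow_const 2).ennreal_ofReal

lemma IsBrownianRel.measurable_stepIntegral (hW : IsBrownianRel F Q W) {ι : Type*} [Fintype ι]
    {s t : ι → ℝ≥0} {ξ : ι → Ω → ℝ} (hξ : ∀ i, Measurable (ξ i)) :
    Measurable (stepIntegral W s t ξ) :=
  Finset.measurable_fun_sum _ fun i _ =>
    (hξ i).mul ((hW.measurable _).sub (hW.measurable _))

/-- The isometry carries over to the Itô integral of `H`: elementary integrals are as close to it
as the elementary integrands are to `H`. -/
theorem IsItoIntegral.eLpNorm_stepIntegral_sub_le [IsFiniteMeasure Q] (hW : IsBrownianRel F Q W)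
    {ι : Type*} [Fintype ι] {s t : ι → ℝ≥0} {ξ : ι → Ω → ℝ} {a b : ℝ≥0} {C : ℝ}
    {H : ℝ≥0 → Ω → ℝ} {J : Ω → ℝ} (hJ : IsItoIntegral F Q W H a b J)
    (hH : AEMeasurable (fun p : Ω × ℝ => H p.2.toNNReal p.1) (spaceTime Q a b))
    (hst : ∀ i, s i ≤ t i) (has : ∀ i, a ≤ s i) (htb : ∀ i, t i ≤ b)
    (hξ : ∀ i, Measurable[F (s i)] (ξ i)) (hC : ∀ i x, |ξ i x| ≤ C) :
    eLpNorm (stepIntegral W s t ξ - J) 2 Q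
      ≤ eLpNorm (stepProcess s t ξ - fun p => H p.2.toNNReal p.1) 2 (spaceTime Q a b) := by
  obtain ⟨hJ2, V, hV, hVJ⟩ := hJ
  obtain ⟨S, hS⟩ : ∃ S : ℕ → Ω → ℝ, ∀ n, S n = stepIntegral W (fun i => (V n).time i.castSucc)
    (fun i => (V n).time i.succ) (V n).coeff := ⟨_, fun _ => rfl⟩
  obtain ⟨P, hP⟩ : ∃ P : ℕ → Ω × ℝ → ℝ, ∀ n, P n = stepProcess
    (fun i => (V n).time i.castSucc) (fun i => (V n).time i.succ) (V n).coeff := ⟨_, fun _ => rfl⟩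
  have hξ' : ∀ i, Measurable (ξ i) := fun i => (hξ i).mono (F.le _) le_rfl
  have hcm : ∀ n i, Measurable ((V n).coeff i) := fun n i =>
    ((V n).coeff_measurable i).mono (F.le _) le_rfl
  have hPm : ∀ n, AEMeasurable (P n) (spaceTime Q a b) := fun n =>
    hP n ▸ (measurable_stepProcess (hcm n)).aemeasurable
  have hUm : AEMeasurable (stepProcess s t ξ) (spaceTime Q a b) :=
    (measurable_stepProcess hξ').aemeasurable
  have hSm : ∀ n, AEStronglyMeasurable (S n) Q := fun n =>
    hS n ▸ (hW.measurable_stepIntegral (hcm n)).aestronglyMeasurable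
  have hTm : AEStronglyMeasurable (stepIntegral W s t ξ) Q :=
    (hW.measurable_stepIntegral hξ').aestronglyMeasurable
  have h1 : ∀ n, eLpNorm (stepIntegral W s t ξ - S n) 2 Q
      = eLpNorm (stepProcess s t ξ - P n) 2 (spaceTime Q a b) := by
    intro n
    obtain ⟨C', hC'⟩ := (V n).coeff_bounded
    rw [hS, hP]
    refine hW.eLpNorm_stepIntegral_sub hst has htb hξ hC
      (fun i => (V n).time_mono (Fin.castSucc_le_succ i)) (fun i => ?_) (fun i => ?_)
      (V n).coeff_measurable hC'
    · calc a = (V n).time 0 := (V n).time_zero.symm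
        _ ≤ _ := (V n).time_mono (Fin.zero_le _)
    · calc _ ≤ (V n).time (Fin.last _) := (V n).time_mono (Fin.le_last _)
        _ = b := (V n).time_last
  have h2 : Tendsto (fun n => eLpNorm (P n - fun p => H p.2.toNNReal p.1) 2 (spaceTime Q a b))
      atTop (𝓝 0) := by
    have : ∀ n, eLpNorm (P n - fun p => H p.2.toNNReal p.1) 2 (spaceTime Q a b)
        = (∫⁻ x, (∫⁻ s in Set.Icc (a : ℝ) b, ENNReal.ofReal
          (((V n).value s.toNNReal x - H s.toNNReal x) ^ 2)) ∂Q) ^ (2 : ℝ)⁻¹ := fun n => by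
      rw [eLpNorm_spaceTime ((hPm n).sub hH)]
      simp only [Pi.sub_apply, hP, stepProcess, SimpleIntegrand.value]
    simp only [this]
    simpa using hV.ennrpow_const (2 : ℝ)⁻¹
  have h3 : ∀ n, eLpNorm (stepIntegral W s t ξ - J) 2 Q
      ≤ eLpNorm (stepProcess s t ξ - fun p => H p.2.toNNReal p.1) 2 (spaceTime Q a b)
        + eLpNorm (P n - fun p => H p.2.toNNReal p.1) 2 (spaceTime Q a b)
        + eLpNorm (S n - J) 2 Q := by
    intro n
    calc eLpNorm (stepIntegral W s t ξ - J) 2 Q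
        = eLpNorm ((stepIntegral W s t ξ - S n) + (S n - J)) 2 Q := by rw [sub_add_sub_cancel]
      _ ≤ eLpNorm (stepIntegral W s t ξ - S n) 2 Q + eLpNorm (S n - J) 2 Q :=
        eLpNorm_add_le (hTm.sub (hSm n)) ((hSm n).sub hJ2.1) one_le_two
      _ ≤ _ := by
        gcongr
        rw [h1]
        calc eLpNorm (stepProcess s t ξ - P n) 2 (spaceTime Q a b)
            = eLpNorm ((stepProcess s t ξ - fun p => H p.2.toNNReal p.1)
              - (P n - fun p => H p.2.toNNReal p.1)) 2 (spaceTime Q a b) := by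
              rw [sub_sub_sub_cancel_right]
          _ ≤ _ := eLpNorm_sub_le (hUm.sub hH).aestronglyMeasurable
              ((hPm n).sub hH).aestronglyMeasurable one_le_two
  have h4 : Tendsto (fun n => eLpNorm (S n - J) 2 Q) atTop (𝓝 0) := by
    refine hVJ.congr fun n => ?_
    rw [hS]
    rfl
  have h5 := (h2.const_add (eLpNorm (stepProcess s t ξ - fun p => H p.2.toNNReal p.1) 2
    (spaceTime Q a b))).add h4
  rw [add_zero, add_zero] at h5
  exact ge_of_tendsto' h5 h3

variable {N K : ℕ} {τ : Fin (N + 1) → ℝ≥0} {A : Fin N → Matrix (Fin K) (Fin K) ℝ}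
  {Z : ℝ≥0 → Ω → Fin K}

lemma IsMarkovChain.measurable (hZ : IsMarkovChain F Q τ A Z) {t : ℝ≥0}
    (ht : t ≤ τ (Fin.last N)) : Measurable (Z t) :=
  (hZ.adapted t ht).mono (F.le t) le_rfl

/-- By right-continuity, the regime is jointly measurable in time and space up to null sets. -/
lemma IsMarkovChain.aemeasurable_spaceTime [IsFiniteMeasure Q] (hZ : IsMarkovChain F Q τ A Z)
    {a b : ℝ≥0} (hb : b ≤ τ (Fin.last N)) (f : Fin K → ℝ) :
    AEMeasurable (fun p : Ω × ℝ => f (Z p.2.toNNReal p.1)) (spaceTime Q a b) := by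
  -- the points `⌈s (m + 1)⌉ / (m + 1)`, cut off at the horizon, approach `s` from the right
  let r : ℕ → ℕ → ℝ≥0 := fun m k => min ((k : ℝ≥0) / (m + 1)) (τ (Fin.last N))
  refine aemeasurable_of_tendsto_metrizable_ae atTop
    (f := fun m (p : Ω × ℝ) => f (Z (r m ⌈p.2.toNNReal * ((m : ℝ≥0) + 1)⌉₊) p.1)) (fun m => ?_) ?_
  · have h1 : Measurable fun q : Ω × ℕ => f (Z (r m q.2) q.1) :=
      measurable_from_prod_countable_left fun k =>
        (measurable_of_finite f).comp (hZ.measurable (t := r m k) (min_le_right _ _))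
    have h2 : Measurable fun p : Ω × ℝ => (p.1, ⌈p.2.toNNReal * ((m : ℝ≥0) + 1)⌉₊) :=
      measurable_fst.prodMk (Nat.measurable_ceil.comp
        ((measurable_real_toNNReal.comp measurable_snd).mul_const _))
    exact (h1.comp h2).aemeasurable
  have hx : ∀ᵐ p ∂(spaceTime Q a b), ∀ t, t < τ (Fin.last N) →
      ContinuousWithinAt (fun s => Z s p.1) (Set.Ici t) t :=
    Measure.quasiMeasurePreserving_fst.ae hZ.right_continuous
  have hs : ∀ᵐ p ∂(spaceTime Q a b), p.2 ∈ Set.Ico (a : ℝ) b := by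
    refine Measure.quasiMeasurePreserving_snd.ae (p := fun s => s ∈ Set.Ico (a : ℝ) b) ?_
    rw [← restrict_Ico_eq_restrict_Icc]
    exact ae_restrict_mem measurableSet_Ico
  filter_upwards [hx, hs] with p hp hps
  set t := p.2.toNNReal with ht
  have htb : t < τ (Fin.last N) :=
    lt_of_lt_of_le ((Real.toNNReal_lt_iff_lt_coe (a.2.trans hps.1)).2 hps.2) hb
  have hlim : Tendsto (fun m : ℕ => r m ⌈t * ((m : ℝ≥0) + 1)⌉₊) atTop (𝓝[Set.Ici t] t) := by
    refine tendsto_nhdsWithin_iff.2 ⟨?_, Eventually.of_forall fun m => ?_⟩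
    · have h1 : Tendsto (fun m : ℕ => ((⌈t * ((m : ℝ≥0) + 1)⌉₊ : ℝ≥0)) / (m + 1)) atTop (𝓝 t) := by
        have := (tendsto_nat_ceil_mul_div_atTop (R := ℝ) (a := t) t.2).comp
          ((tendsto_natCast_atTop_atTop (R := ℝ)).comp (tendsto_add_atTop_nat 1))
        rw [← NNReal.tendsto_coe]
        refine this.congr fun m => ?_
        simp only [Function.comp_apply, NNReal.coe_div, NNReal.coe_natCast, NNReal.coe_add,
          NNReal.coe_one, Nat.cast_add, Nat.cast_one]
        congr 2
      simpa [r, min_eq_left htb.le] using h1.min (tendsto_const_nhds (x := τ (Fin.last N)))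
    · refine le_min ?_ htb.le
      rw [le_div_iff₀ (by positivity)]
      exact Nat.le_ceil _
  exact ((continuous_of_discreteTopology (f := f)).tendsto _).comp ((hp t htb).tendsto.comp hlim)

/-- On one period, regimes at nearby times differ with probability at most linear in the lag. -/
lemma IsMarkovChain.measure_ne_le [IsProbabilityMeasure Q] (hZ : IsMarkovChain F Q τ A Z)
    (n : Fin N) : ∃ C δ : ℝ, 0 ≤ C ∧ 0 < δ ∧ ∀ s t : ℝ≥0, τ n.castSucc ≤ s → s ≤ t →
      t ≤ τ n.succ → (t : ℝ) - s < δ → Q.real {x | Z s x ≠ Z t x} ≤ C * ((t : ℝ) - s) := by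
  choose! δ hδ0 hδ using fun i j => hZ.rates n i j 1 one_pos
  obtain ⟨d, hd0, hd⟩ : ∃ d : ℝ, 0 < d ∧ ∀ i j, d ≤ δ i j := by
    refine (isEmpty_or_nonempty (Fin K × Fin K)).elim
      (fun _ => ⟨1, one_pos, fun i j => isEmptyElim (i, j)⟩) fun _ => ?_
    obtain ⟨p, hp⟩ := Finite.exists_min fun p : Fin K × Fin K => δ p.1 p.2
    exact ⟨δ p.1 p.2, hδ0 _ _, fun i j => hp (i, j)⟩
  refine ⟨∑ i, ∑ j, (|A n i j| + 1), d, by positivity, hd0, fun s t hs hst ht hlt => ?_⟩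
  have h0 : (0 : ℝ) ≤ (t : ℝ) - s := sub_nonneg.2 (by exact_mod_cast hst)
  have hsub : {x | Z s x ≠ Z t x} ⊆ ⋃ p ∈ (Finset.univ.filter fun p : Fin K × Fin K => p.1 ≠ p.2),
      {x | Z s x = p.1 ∧ Z t x = p.2} := by
    intro x hx
    simp only [Set.mem_iUnion]
    exact ⟨(Z s x, Z t x), by simpa using hx, rfl, rfl⟩
  calc Q.real {x | Z s x ≠ Z t x}
      ≤ Q.real (⋃ p ∈ (Finset.univ.filter fun p : Fin K × Fin K => p.1 ≠ p.2),
        {x | Z s x = p.1 ∧ Z t x = p.2}) := measureReal_mono hsub (measure_ne_top _ _)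
    _ ≤ ∑ p ∈ (Finset.univ.filter fun p : Fin K × Fin K => p.1 ≠ p.2),
        Q.real {x | Z s x = p.1 ∧ Z t x = p.2} := measureReal_biUnion_finset_le _ _
    _ ≤ ∑ p ∈ (Finset.univ.filter fun p : Fin K × Fin K => p.1 ≠ p.2),
        (|A n p.1 p.2| + 1) * ((t : ℝ) - s) := by
      refine Finset.sum_le_sum fun p hp => ?_
      have hne : p.1 ≠ p.2 := by simpa using hp
      have h := hδ p.1 p.2 s t hs hst ht (hlt.trans_le (hd _ _))
      rw [if_neg hne, zero_add, one_mul] at h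
      have h1 := (abs_le.1 h).2
      have hq : Q.real {x | Z s x = p.1} ≤ 1 := measureReal_le_one
      have h2 : Q.real {x | Z s x = p.1} * (((t : ℝ) - s) * A n p.1 p.2)
          ≤ ((t : ℝ) - s) * |A n p.1 p.2| := by
        calc _ ≤ Q.real {x | Z s x = p.1} * (((t : ℝ) - s) * |A n p.1 p.2|) := by
              gcongr; exact le_abs_self _
          _ ≤ 1 * (((t : ℝ) - s) * |A n p.1 p.2|) := by gcongr
          _ = _ := one_mul _
      have h3 : ((t : ℝ) - s) * Q.real {x | Z s x = p.1} ≤ ((t : ℝ) - s) := by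
        simpa using mul_le_mul_of_nonneg_left hq h0
      linarith
    _ ≤ ∑ p : Fin K × Fin K, (|A n p.1 p.2| + 1) * ((t : ℝ) - s) :=
      Finset.sum_le_sum_of_subset_of_nonneg (Finset.filter_subset _ _)
        fun _ _ _ => by positivity
    _ = _ := by rw [← Finset.sum_mul, Fintype.sum_prod_type]

/-- The `k`-th point of the grid dividing `[a, b]` into `m` equal parts. For `m = 0` all points
equal `a`, because division by zero gives zero. -/
noncomputable def grid (a b : ℝ≥0) (m k : ℕ) : ℝ≥0 := a + k * ((b - a) / m)

lemma grid_zero (a b : ℝ≥0) (m : ℕ) : grid a b m 0 = a := by simp [grid]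

lemma grid_self {a b : ℝ≥0} (hab : a ≤ b) {m : ℕ} (hm : m ≠ 0) : grid a b m m = b := by
  have : (m : ℝ≥0) ≠ 0 := by exact_mod_cast hm
  rw [grid, mul_div_cancel₀ _ this, add_tsub_cancel_of_le hab]

lemma grid_mono (a b : ℝ≥0) (m : ℕ) : Monotone (grid a b m) := fun k l h => by
  unfold grid; gcongr

lemma le_grid (a b : ℝ≥0) (m k : ℕ) : a ≤ grid a b m k := le_self_add

lemma grid_le {a b : ℝ≥0} (hab : a ≤ b) {m k : ℕ} (hk : k ≤ m) : grid a b m k ≤ b := by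
  rcases eq_or_ne m 0 with rfl | hm
  · simpa [grid] using hab
  · exact (grid_mono a b m hk).trans (grid_self hab hm).le

lemma grid_succ_sub {a b : ℝ≥0} (hab : a ≤ b) (m k : ℕ) :
    (grid a b m (k + 1) : ℝ) - grid a b m k = ((b : ℝ) - a) / m := by
  simp only [grid, NNReal.coe_add, NNReal.coe_mul, NNReal.coe_div, NNReal.coe_sub hab]
  push_cast
  ring

lemma exists_mem_Ioc_grid {a b s : ℝ≥0} {m : ℕ} (hm : m ≠ 0) (hs : s ∈ Set.Ioc a b) :
    ∃ k < m, s ∈ Set.Ioc (grid a b m k) (grid a b m (k + 1)) := by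
  have hab : a ≤ b := (hs.1.trans_le hs.2).le
  have hex : ∃ k, s ≤ grid a b m k := ⟨m, by rw [grid_self hab hm]; exact hs.2⟩
  have h0 : Nat.find hex ≠ 0 := fun h => by
    have := Nat.find_spec hex
    rw [h, grid_zero] at this
    exact absurd hs.1 (not_lt.2 this)
  obtain ⟨k, hk⟩ := Nat.exists_eq_succ_of_ne_zero h0
  refine ⟨k, ?_, ?_, ?_⟩
  · have : Nat.find hex ≤ m := Nat.find_min' hex (by rw [grid_self hab hm]; exact hs.2)
    lia
  · exact not_le.1 (Nat.find_min hex (m := k) (by lia))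
  · have := Nat.find_spec hex
    rwa [hk] at this

lemma stepProcess_grid {a b : ℝ≥0} {m k : ℕ} (hk : k < m) {ξ : Fin m → Ω → ℝ} {p : Ω × ℝ}
    (hp : p.2.toNNReal ∈ Set.Ioc (grid a b m k) (grid a b m (k + 1))) :
    stepProcess (fun i : Fin m => grid a b m i) (fun i => grid a b m (i + 1)) ξ p
      = ξ ⟨k, hk⟩ p.1 := by
  rw [stepProcess, Finset.sum_eq_single ⟨k, hk⟩]
  · exact Set.indicator_of_mem hp _
  · intro i _ hi
    refine Set.indicator_of_notMem (fun hi' => hi (Fin.ext ?_)) _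
    have h1 : (i : ℕ) < k + 1 := (grid_mono a b m).reflect_lt (hi'.1.trans_le hp.2)
    have h2 : k < i + 1 := (grid_mono a b m).reflect_lt (hp.1.trans_le hi'.2)
    simp only; lia
  · simp

end Euler

section EulerConvergence

variable {Ω : Type*} {mΩ : MeasurableSpace Ω} {Q : Measure Ω} {F : Filtration ℝ≥0 mΩ}
  {W : ℝ≥0 → Ω → ℝ} {N K : ℕ} {τ : Fin (N + 1) → ℝ≥0} {A : Fin N → Matrix (Fin K) (Fin K) ℝ}
  {Z : ℝ≥0 → Ω → Fin K}

/-- The elementary process that freezes `f (Z s)` at the last of `m` equidistant grid points. -/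
noncomputable def frozen (a b : ℝ≥0) (Z : ℝ≥0 → Ω → Fin K) (f : Fin K → ℝ) (m : ℕ) :
    Ω × ℝ → ℝ :=
  stepProcess (fun i : Fin m => grid a b m i) (fun i => grid a b m (i + 1))
    (fun i x => f (Z (grid a b m i) x))

lemma exists_abs_le (f : Fin K → ℝ) : ∃ M : ℝ, 0 ≤ M ∧ ∀ k, |f k| ≤ M :=
  ⟨∑ k, |f k|, by positivity,
    fun k => Finset.single_le_sum (f := fun k => |f k|) (fun _ _ => abs_nonneg _)
      (Finset.mem_univ k)⟩

lemma IsMarkovChain.measurable_frozen (hZ : IsMarkovChain F Q τ A Z) {a b : ℝ≥0} (hab : a ≤ b)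
    (hb : b ≤ τ (Fin.last N)) (f : Fin K → ℝ) (m : ℕ) : Measurable (frozen a b Z f m) :=
  measurable_stepProcess fun i => (measurable_of_finite f).comp
    (hZ.measurable ((grid_le hab i.2.le).trans hb))

/-- Freezing the regime on a fine grid changes any function of it little in mean square, because
the regime rarely jumps during a short time. -/
theorem IsMarkovChain.tendsto_frozen [IsProbabilityMeasure Q] (hZ : IsMarkovChain F Q τ A Z)
    (hτ : Monotone τ) (n : Fin N) (f : Fin K → ℝ) :
    Tendsto (fun m => eLpNorm (frozen (τ n.castSucc) (τ n.succ) Z f m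
      - fun p => f (Z p.2.toNNReal p.1)) 2 (spaceTime Q (τ n.castSucc) (τ n.succ)))
      atTop (𝓝 0) := by
  set a := τ n.castSucc with ha
  set b := τ n.succ with hb
  have hab : a ≤ b := hτ (Fin.castSucc_le_succ n)
  have hbT : b ≤ τ (Fin.last N) := hτ (Fin.le_last _)
  obtain ⟨M, hM0, hM⟩ := exists_abs_le f
  obtain ⟨C, δ, hC0, hδ0, hC⟩ := hZ.measure_ne_le n
  have hZm := hZ.aemeasurable_spaceTime (a := a) hbT f
  have hdm : ∀ m, AEMeasurable (frozen a b Z f m - fun p => f (Z p.2.toNNReal p.1))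
      (spaceTime Q a b) := fun m => (hZ.measurable_frozen hab hbT f m).aemeasurable.sub hZm
  have hab0 : (0 : ℝ) ≤ (b : ℝ) - a := sub_nonneg.2 (by exact_mod_cast hab)
  have hlim0 : Tendsto (fun m : ℕ => ((b : ℝ) - a) / m) atTop (𝓝 0) :=
    tendsto_const_div_atTop_nhds_zero_nat _
  have hkey : ∀ᶠ m : ℕ in atTop,
      eLpNorm (frozen a b Z f m - fun p => f (Z p.2.toNNReal p.1)) 2 (spaceTime Q a b)
        ≤ (ENNReal.ofReal ((2 * M) ^ 2 * (C * (((b : ℝ) - a) / m)) * ((b : ℝ) - a)))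
          ^ (2 : ℝ)⁻¹ := by
    filter_upwards [hlim0.eventually_lt_const hδ0, eventually_ne_atTop 0] with m hm hm0
    rw [eLpNorm_two_eq_lintegral]
    refine ENNReal.rpow_le_rpow ?_ (by positivity)
    rw [spaceTime, lintegral_prod_symm _ (by
      exact ((hdm m).pow_const 2).ennreal_ofReal)]
    have hpt : ∀ s ∈ Set.Ioc (a : ℝ) b, ∫⁻ x, ENNReal.ofReal
        ((frozen a b Z f m - fun p : Ω × ℝ => f (Z p.2.toNNReal p.1)) (x, s) ^ 2) ∂Q
        ≤ ENNReal.ofReal ((2 * M) ^ 2 * (C * (((b : ℝ) - a) / m))) := by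
      intro s hs
      lift s to ℝ≥0 using a.2.trans hs.1.le
      obtain ⟨k, hk, hks⟩ := exists_mem_Ioc_grid hm0 (s := s)
        ⟨by exact_mod_cast hs.1, by exact_mod_cast hs.2⟩
      set u := grid a b m k with hu
      have hsu : (s : ℝ) - u ≤ ((b : ℝ) - a) / m := by
        rw [← grid_succ_sub hab m k]
        exact sub_le_sub_right (by exact_mod_cast hks.2) _
      have hsb : s ≤ b := by exact_mod_cast hs.2
      have hmeas : MeasurableSet {x | Z u x ≠ Z s x} :=
        (measurableSet_eq_fun (hZ.measurable ((grid_le hab hk.le).trans hbT))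
          (hZ.measurable (hsb.trans hbT))).compl
      calc ∫⁻ x, ENNReal.ofReal
            ((frozen a b Z f m - fun p : Ω × ℝ => f (Z p.2.toNNReal p.1)) (x, (s : ℝ)) ^ 2) ∂Q
          ≤ ∫⁻ x, {x | Z u x ≠ Z s x}.indicator (fun _ => ENNReal.ofReal ((2 * M) ^ 2)) x ∂Q := by
            refine lintegral_mono fun x => ?_
            have : frozen a b Z f m (x, (s : ℝ)) = f (Z u x) := by
              rw [frozen, stepProcess_grid hk (by simpa using hks)]
            rw [Pi.sub_apply, this]
            simp only [Real.toNNReal_coe]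
            by_cases hx : Z u x = Z s x
            · simp [hx]
            · rw [Set.indicator_of_mem (by exact hx)]
              refine ENNReal.ofReal_le_ofReal (sq_le_sq' ?_ ?_) <;>
              · have h1 := abs_le.1 (hM (Z u x))
                have h2 := abs_le.1 (hM (Z s x))
                linarith
        _ = ENNReal.ofReal ((2 * M) ^ 2) * Q {x | Z u x ≠ Z s x} :=
            lintegral_indicator_const hmeas _
        _ = ENNReal.ofReal ((2 * M) ^ 2 * Q.real {x | Z u x ≠ Z s x}) := by
            rw [ENNReal.ofReal_mul (by positivity), ofReal_measureReal]
        _ ≤ _ := by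
            refine ENNReal.ofReal_le_ofReal (mul_le_mul_of_nonneg_left ?_ (by positivity))
            exact (hC u s (le_grid _ _ _ _) hks.1.le hsb (hsu.trans_lt hm)).trans
              (mul_le_mul_of_nonneg_left hsu hC0)
    rw [← restrict_Ioc_eq_restrict_Icc]
    calc _ ≤ ∫⁻ s in Set.Ioc (a : ℝ) b,
          ENNReal.ofReal ((2 * M) ^ 2 * (C * (((b : ℝ) - a) / m))) :=
          setLIntegral_mono measurable_const hpt
      _ = _ := by
          rw [setLIntegral_const, Real.volume_Ioc, ← ENNReal.ofReal_mul (by positivity)]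
  refine tendsto_of_tendsto_of_tendsto_of_le_of_le' tendsto_const_nhds ?_
    (Eventually.of_forall fun _ => bot_le) hkey
  have h1 : Tendsto (fun m : ℕ => (2 * M) ^ 2 * (C * (((b : ℝ) - a) / m)) * ((b : ℝ) - a))
      atTop (𝓝 0) := by
    simpa using ((hlim0.const_mul C).const_mul ((2 * M) ^ 2)).mul_const ((b : ℝ) - a)
  simpa using (ENNReal.tendsto_ofReal h1).ennrpow_const (2 : ℝ)⁻¹

/-- Integrating in time is bounded from `L²(Q × ds)` to `L²(Q)`. -/
lemma eLpNorm_integral_le [SFinite Q] {a b : ℝ≥0} {g : Ω × ℝ → ℝ}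
    (hg : AEMeasurable g (spaceTime Q a b)) :
    eLpNorm (fun x => ∫ s in Set.Icc (a : ℝ) b, g (x, s)) 2 Q
      ≤ ENNReal.ofReal ((b : ℝ) - a) ^ (2 : ℝ)⁻¹ * eLpNorm g 2 (spaceTime Q a b) := by
  rw [eLpNorm_two_eq_lintegral, eLpNorm_spaceTime hg, ← ENNReal.mul_rpow_of_nonneg _ _ (by simp)]
  refine ENNReal.rpow_le_rpow ?_ (by simp)
  rw [← lintegral_const_mul' _ _ ENNReal.ofReal_ne_top]
  have hsec : ∀ᵐ x ∂Q, AEStronglyMeasurable (fun s => g (x, s))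
      (volume.restrict (Set.Icc (a : ℝ) b)) := hg.aestronglyMeasurable.prodMk_left
  refine lintegral_mono_ae ?_
  filter_upwards [hsec] with x hx
  have h1 : ‖∫ s in Set.Icc (a : ℝ) b, g (x, s)‖ₑ
      ≤ (∫⁻ s in Set.Icc (a : ℝ) b, ENNReal.ofReal (g (x, s) ^ 2)) ^ (2 : ℝ)⁻¹
        * ENNReal.ofReal ((b : ℝ) - a) ^ (2 : ℝ)⁻¹ := by
    calc _ ≤ ∫⁻ s in Set.Icc (a : ℝ) b, ‖g (x, s)‖ₑ := enorm_integral_le_lintegral_enorm _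
      _ = eLpNorm (fun s => g (x, s)) 1 (volume.restrict (Set.Icc (a : ℝ) b)) :=
        eLpNorm_one_eq_lintegral_enorm.symm
      _ ≤ eLpNorm (fun s => g (x, s)) 2 (volume.restrict (Set.Icc (a : ℝ) b))
          * (volume.restrict (Set.Icc (a : ℝ) b)) Set.univ ^ (2 : ℝ)⁻¹ := by
        convert eLpNorm_le_eLpNorm_mul_rpow_measure_univ one_le_two hx using 3
        norm_num
      _ = _ := by
        rw [eLpNorm_two_eq_lintegral, Measure.restrict_apply_univ, Real.volume_Icc]
  have h2 : ENNReal.ofReal ((∫ s in Set.Icc (a : ℝ) b, g (x, s)) ^ 2)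
      = ‖∫ s in Set.Icc (a : ℝ) b, g (x, s)‖ₑ ^ 2 := by
    rw [← sq_abs, ← Real.norm_eq_abs, ENNReal.ofReal_pow (norm_nonneg _), ofReal_norm]
  rw [h2]
  calc _ ≤ ((∫⁻ s in Set.Icc (a : ℝ) b, ENNReal.ofReal (g (x, s) ^ 2)) ^ (2 : ℝ)⁻¹
        * ENNReal.ofReal ((b : ℝ) - a) ^ (2 : ℝ)⁻¹) ^ 2 := by gcongr
    _ = _ := by
      rw [mul_pow, ← ENNReal.rpow_natCast, ← ENNReal.rpow_natCast, ← ENNReal.rpow_mul,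
        ← ENNReal.rpow_mul]
      norm_num [mul_comm]

/-- The first `k` steps of the Euler scheme on `m` equidistant steps of `[a, b]` for
`dX = c(Z) dt + σ(Z) dW` started at `0`. -/
noncomputable def eulerSum (a b : ℝ≥0) (c σ : Fin K → ℝ) (Z : ℝ≥0 → Ω → Fin K)
    (W : ℝ≥0 → Ω → ℝ) (m k : ℕ) (x : Ω) : ℝ :=
  ∑ l ∈ Finset.range k, (c (Z (grid a b m l) x) * (((b : ℝ) - a) / m)
    + σ (Z (grid a b m l) x) * (W (grid a b m (l + 1)) x - W (grid a b m l) x))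

lemma measurable_eulerSum (hZ : IsMarkovChain F Q τ A Z) (hW : IsBrownianRel F Q W) {a b : ℝ≥0}
    (hab : a ≤ b) (hb : b ≤ τ (Fin.last N)) (c σ : Fin K → ℝ) {m k : ℕ} (hk : k ≤ m) :
    Measurable[F (grid a b m k)] (eulerSum a b c σ Z W m k) := by
  refine Finset.measurable_fun_sum _ fun l hl => ?_
  have hlk : l < k := Finset.mem_range.1 hl
  have hZl : Measurable[F (grid a b m k)] (Z (grid a b m l)) :=
    (hZ.adapted _ ((grid_le hab (hlk.le.trans hk)).trans hb)).mono
      (F.mono (grid_mono a b m hlk.le)) le_rfl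
  exact (((measurable_of_finite c).comp hZl).mul_const _).add
    (((measurable_of_finite σ).comp hZl).mul
      (hW.measurable_sub (grid_mono a b m hlk.le) (grid_mono a b m hlk)))

lemma integral_frozen {a b : ℝ≥0} (hab : a ≤ b) (f : Fin K → ℝ) (m : ℕ) (x : Ω) :
    ∫ s in Set.Icc (a : ℝ) b, frozen a b Z f m (x, s)
      = ∑ l ∈ Finset.range m, f (Z (grid a b m l) x) * (((b : ℝ) - a) / m) := by
  have hm : ∀ i : Fin m, Measurable fun s : ℝ =>
      (Set.Ioc (grid a b m i) (grid a b m (i + 1))).indicator (fun _ => (1 : ℝ)) s.toNNReal :=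
    fun i => (measurable_const.indicator measurableSet_Ioc).comp measurable_real_toNNReal
  have e : ∀ s : ℝ, frozen a b Z f m (x, s) = ∑ i : Fin m, f (Z (grid a b m i) x) *
      ((Set.Ioc (grid a b m i) (grid a b m (i + 1))).indicator (fun _ => (1 : ℝ)) s.toNNReal
      * (Set.Ioc (grid a b m i) (grid a b m (i + 1))).indicator (fun _ => (1 : ℝ))
        s.toNNReal) := by
    intro s
    rw [frozen, stepProcess]
    refine Finset.sum_congr rfl fun i _ => ?_
    simp only [Set.indicator]
    split_ifs <;> simp
  simp only [e]
  rw [integral_finsetSum, Finset.sum_range]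
  · refine Finset.sum_congr rfl fun i _ => ?_
    rw [integral_const_mul, setIntegral_indicator_Ioc_mul (le_grid _ _ _ _) (grid_le hab i.2),
      min_self, max_self, NNReal.coe_sub (grid_mono a b m (Nat.le_succ _)), grid_succ_sub hab]
  · intro i _
    refine Integrable.const_mul (Integrable.of_bound ((hm i).mul (hm i)).aestronglyMeasurable 1
        (Eventually.of_forall fun r => ?_)) _
    simp only [Pi.mul_apply, Set.indicator]
    split_ifs <;> simp

/-- On each period, the Euler scheme converges in `L²` to the increment of the solution. -/
theorem tendsto_eulerSum [IsProbabilityMeasure Q] (hZ : IsMarkovChain F Q τ A Z)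
    (hτ : Monotone τ) (hW : IsBrownianRel F Q W) (n : Fin N) (c σ : Fin K → ℝ) {J : Ω → ℝ}
    (hJ : IsItoIntegral F Q W (fun s x => σ (Z s x)) (τ n.castSucc) (τ n.succ) J) :
    Tendsto (fun m => eLpNorm (eulerSum (τ n.castSucc) (τ n.succ) c σ Z W m m
      - fun x => (∫ s in (τ n.castSucc : ℝ)..(τ n.succ), c (Z s.toNNReal x)) + J x) 2 Q)
      atTop (𝓝 0) ∧
    AEStronglyMeasurable (fun x => (∫ s in (τ n.castSucc : ℝ)..(τ n.succ), c (Z s.toNNReal x))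
      + J x) Q := by
  have hσf := hZ.tendsto_frozen hτ n σ
  have hcf := hZ.tendsto_frozen hτ n c
  set a := τ n.castSucc with ha
  set b := τ n.succ with hb
  have hab : a ≤ b := hτ (Fin.castSucc_le_succ n)
  have hab' : (a : ℝ) ≤ b := by exact_mod_cast hab
  have hbT : b ≤ τ (Fin.last N) := hτ (Fin.le_last _)
  have hcm := hZ.aemeasurable_spaceTime (a := a) hbT c
  have hσm := hZ.aemeasurable_spaceTime (a := a) hbT σ
  obtain ⟨Mσ, -, hMσ⟩ := exists_abs_le σ
  obtain ⟨Mc, -, hMc⟩ := exists_abs_le c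
  have hfm := fun m => (hZ.measurable_frozen (Q := Q) hab hbT c m)
  have hdm : ∀ m, AEMeasurable (frozen a b Z c m - fun p => c (Z p.2.toNNReal p.1))
      (spaceTime Q a b) := fun m => (hfm m).aemeasurable.sub hcm
  have hDm : AEStronglyMeasurable (fun x => ∫ s in Set.Icc (a : ℝ) b, c (Z s.toNNReal x)) Q :=
    hcm.aestronglyMeasurable.integral_prod_right'
  have hD : ∀ x, (∫ s in (a : ℝ)..b, c (Z s.toNNReal x))
      = ∫ s in Set.Icc (a : ℝ) b, c (Z s.toNNReal x) := fun x => by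
    rw [intervalIntegral.integral_of_le hab', integral_Icc_eq_integral_Ioc]
  simp only [hD]
  refine ⟨?_, hDm.add hJ.1.1⟩
  let S : ℕ → Ω → ℝ := fun m => stepIntegral W (fun i : Fin m => grid a b m i)
    (fun i => grid a b m (i + 1)) (fun i x => σ (Z (grid a b m i) x))
  have hSm : ∀ m, Measurable (S m) := fun m => hW.measurable_stepIntegral fun i =>
    (measurable_of_finite σ).comp (hZ.measurable ((grid_le hab i.2.le).trans hbT))
  -- the Euler sum splits into a time integral and an elementary stochastic integral
  have hsplit : ∀ m, (eulerSum a b c σ Z W m m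
      - fun x => (∫ s in Set.Icc (a : ℝ) b, c (Z s.toNNReal x)) + J x)
      = (fun x => (∫ s in Set.Icc (a : ℝ) b, frozen a b Z c m (x, s))
        - ∫ s in Set.Icc (a : ℝ) b, c (Z s.toNNReal x)) + (S m - J) := by
    intro m
    ext x
    simp only [Pi.sub_apply, Pi.add_apply, eulerSum, integral_frozen hab, Finset.sum_add_distrib,
      S, stepIntegral]
    rw [Finset.sum_range (fun l => σ (Z (grid a b m l) x)
      * (W (grid a b m (l + 1)) x - W (grid a b m l) x))]
    ring
  have hdrift : ∀ m, (fun x => (∫ s in Set.Icc (a : ℝ) b, frozen a b Z c m (x, s))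
        - ∫ s in Set.Icc (a : ℝ) b, c (Z s.toNNReal x))
      =ᵐ[Q] fun x => ∫ s in Set.Icc (a : ℝ) b,
        (frozen a b Z c m - fun p : Ω × ℝ => c (Z p.2.toNNReal p.1)) (x, s) := by
    intro m
    have h1 : ∀ᵐ x ∂Q, AEStronglyMeasurable (fun s : ℝ => c (Z s.toNNReal x))
      (volume.restrict (Set.Icc (a : ℝ) b)) := hcm.aestronglyMeasurable.prodMk_left
    filter_upwards [h1] with x hx
    refine (integral_sub ?_ ?_).symm
    · refine Integrable.of_bound ((hfm m).comp measurable_prodMk_left).aestronglyMeasurable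
        (Fintype.card (Fin m) • Mc) (Eventually.of_forall fun s => ?_)
      rw [frozen, stepProcess, ← Finset.card_univ, ← Finset.sum_const]
      exact norm_sum_le_of_le _ fun i _ => (norm_indicator_le_norm_self _ _).trans (hMc _)
    · exact Integrable.of_bound hx Mc (Eventually.of_forall fun s => hMc _)
  have hle : ∀ m, eLpNorm (eulerSum a b c σ Z W m m
      - fun x => (∫ s in Set.Icc (a : ℝ) b, c (Z s.toNNReal x)) + J x) 2 Q
      ≤ ENNReal.ofReal ((b : ℝ) - a) ^ (2 : ℝ)⁻¹
        * eLpNorm (frozen a b Z c m - fun p => c (Z p.2.toNNReal p.1)) 2 (spaceTime Q a b)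
      + eLpNorm (frozen a b Z σ m - fun p => σ (Z p.2.toNNReal p.1)) 2 (spaceTime Q a b) := by
    intro m
    rw [hsplit]
    refine (eLpNorm_add_le ?_ ?_ one_le_two).trans (add_le_add ?_ ?_)
    · exact (hfm m).aestronglyMeasurable.integral_prod_right'.sub hDm
    · exact (hSm m).aestronglyMeasurable.sub hJ.1.1
    · rw [eLpNorm_congr_ae (hdrift m)]
      exact eLpNorm_integral_le (hdm m)
    · exact hJ.eLpNorm_stepIntegral_sub_le hW hσm (fun i => grid_mono a b m (Nat.le_succ _))
        (fun i => le_grid _ _ _ _) (fun i => grid_le hab i.2)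
        (fun i => (measurable_of_finite σ).comp
          (hZ.adapted _ ((grid_le hab i.2.le).trans hbT))) (fun i x => hMσ _)
  refine tendsto_of_tendsto_of_tendsto_of_le_of_le tendsto_const_nhds ?_
    (fun _ => bot_le) hle
  have h1 := (ENNReal.Tendsto.const_mul hcf (a := ENNReal.ofReal ((b : ℝ) - a) ^ (2 : ℝ)⁻¹)
    (Or.inr (ENNReal.rpow_ne_top_of_nonneg (by simp) ENNReal.ofReal_ne_top))).add hσf
  rwa [mul_zero, zero_add] at h1

end EulerConvergence

/-! ### One step of the scheme -/

section GaussianFactor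

variable {Ω : Type*} {mΩ : MeasurableSpace Ω} {Q : Measure Ω} {F : Filtration ℝ≥0 mΩ}
  {W : ℝ≥0 → Ω → ℝ}

/-- The factor `exp (z (c (t - s) + σ (W t - W s)))` contributed by one time step. -/
noncomputable def stepFactor (W : ℝ≥0 → Ω → ℝ) (z : ℂ) (c σ : ℝ) (s t : ℝ≥0) (x : Ω) : ℂ :=
  Complex.exp (z * ((c * ((t : ℝ) - s) + σ * (W t x - W s x) : ℝ) : ℂ))

lemma norm_stepFactor (z : ℂ) (c σ : ℝ) (s t : ℝ≥0) (x : Ω) :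
    ‖stepFactor W z c σ s t x‖
      = Real.exp (z.re * (c * ((t : ℝ) - s))) * Real.exp (z.re * σ * (W t x - W s x)) := by
  rw [stepFactor, Complex.norm_exp, Complex.re_mul_ofReal, ← Real.exp_add]
  ring_nf

lemma IsBrownianRel.measurable_stepFactor (hW : IsBrownianRel F Q W) (z : ℂ) (c σ : ℝ)
    (s t : ℝ≥0) : Measurable (stepFactor W z c σ s t) := by
  unfold stepFactor
  have h1 := hW.measurable s
  have h2 := hW.measurable t
  fun_prop

lemma IsBrownianRel.indepFun_stepFactor (hW : IsBrownianRel F Q W) {s t : ℝ≥0} (hst : s ≤ t)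
    (z : ℂ) (c σ : ℝ) {β : Type*} [MeasurableSpace β] {Y : Ω → β} (hY : Measurable[F s] Y) :
    IndepFun Y (stepFactor W z c σ s t) Q :=
  (hW.indepFun_increment hst hY).comp (φ := id) measurable_id
    (ψ := fun y => Complex.exp (z * ((c * ((t : ℝ) - s) + σ * y : ℝ) : ℂ))) (by fun_prop)

lemma IsBrownianRel.integrable_stepFactor (hW : IsBrownianRel F Q W) {s t : ℝ≥0} (hst : s ≤ t)
    (z : ℂ) (c σ : ℝ) : Integrable (stepFactor W z c σ s t) Q := by
  have hl := hW.hasLaw_increment hst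
  refine (integrable_norm_iff (hW.measurable_stepFactor z c σ s t).aestronglyMeasurable).1 ?_
  simp only [norm_stepFactor]
  refine Integrable.const_mul ?_ _
  have h := integrable_exp_mul_gaussianReal (μ := 0) (v := t - s) (z.re * σ)
  rw [← hl.map_eq] at h
  exact h.comp_aemeasurable hl.aemeasurable

/-- The expectation of a step factor, from the Gaussian moment generating function. -/
lemma IsBrownianRel.integral_stepFactor (hW : IsBrownianRel F Q W) {s t : ℝ≥0} (hst : s ≤ t)
    (z : ℂ) (c σ : ℝ) :
    ∫ x, stepFactor W z c σ s t x ∂Q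
      = Complex.exp (((t : ℝ) - s : ℝ) * (z * c + z ^ 2 * σ ^ 2 / 2)) := by
  have h := complexMGF_gaussianReal (hW.hasLaw_increment hst).map_eq (z * σ)
  rw [complexMGF] at h
  have e : ∀ x, stepFactor W z c σ s t x = Complex.exp (z * (c * ((t : ℝ) - s : ℝ)))
      * Complex.exp (z * σ * ((W t x - W s x : ℝ) : ℂ)) := fun x => by
    rw [stepFactor, ← Complex.exp_add]; push_cast; ring_nf
  simp only [e]
  rw [integral_const_mul, h, ← Complex.exp_add]
  have : (((t - s : ℝ≥0) : ℝ) : ℂ) = ((t : ℝ) - s : ℝ) := by rw [NNReal.coe_sub hst]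
  rw [this]
  push_cast
  ring_nf

lemma IsBrownianRel.integral_norm_stepFactor (hW : IsBrownianRel F Q W) {s t : ℝ≥0}
    (hst : s ≤ t) (z : ℂ) (c σ : ℝ) :
    ∫ x, ‖stepFactor W z c σ s t x‖ ∂Q
      = Real.exp (((t : ℝ) - s) * (z.re * c + z.re ^ 2 * σ ^ 2 / 2)) := by
  have h := mgf_gaussianReal (hW.hasLaw_increment hst).map_eq (z.re * σ)
  rw [mgf] at h
  simp only [norm_stepFactor]
  rw [integral_const_mul, h, ← Real.exp_add, NNReal.coe_sub hst]
  ring_nf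

lemma norm_exp_sub_one_pow_four_le {α h y : ℝ} (hα : 0 ≤ α) (hh0 : 0 ≤ h) (hh1 : h ≤ 1) {w : ℂ}
    (hw : ‖w‖ ≤ √h * (α * (1 + |y|))) :
    ‖Complex.exp w - 1‖ ^ 4 ≤ h ^ 2 * Real.exp (8 * (α * (1 + |y|))) := by
  set v := α * (1 + |y|) with hv
  have hv0 : 0 ≤ v := by positivity
  have hs1 : √h ≤ 1 := Real.sqrt_le_one.2 hh1
  have h1 : ‖Complex.exp w - 1‖ ≤ ‖w‖ * Real.exp ‖w‖ := by
    simpa using Complex.norm_exp_sub_sum_le_norm_mul_exp w 1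
  have h2 : ‖w‖ ≤ v := hw.trans (by nlinarith)
  have h3 : ‖Complex.exp w - 1‖ ≤ √h * Real.exp (2 * v) := by
    calc _ ≤ _ := h1
      _ ≤ (√h * v) * Real.exp v := by gcongr
      _ ≤ (√h * Real.exp v) * Real.exp v := by
        gcongr
        linarith [Real.add_one_le_exp v]
      _ = _ := by rw [mul_assoc, ← Real.exp_add]; ring_nf
  calc _ ≤ (√h * Real.exp (2 * v)) ^ 4 := by gcongr
    _ = (√h ^ 2) ^ 2 * Real.exp (2 * v) ^ 4 := by ring
    _ = _ := by rw [Real.sq_sqrt hh0, ← Real.exp_nat_mul]; ring_nf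

/-- Brownian scaling makes the fourth moment of `stepFactor - 1` quadratic in the step length. -/
lemma IsBrownianRel.integral_stepFactor_sub_one_le (hW : IsBrownianRel F Q W) (z : ℂ) (c σ : ℝ) :
    ∃ C : ℝ, 0 ≤ C ∧ ∀ s t : ℝ≥0, s ≤ t → (t : ℝ) - s ≤ 1 →
      Integrable (fun x => ‖stepFactor W z c σ s t x - 1‖ ^ 4) Q ∧
      ∫ x, ‖stepFactor W z c σ s t x - 1‖ ^ 4 ∂Q ≤ C * ((t : ℝ) - s) ^ 2 := by
  set α : ℝ := ‖z‖ * (|c| + |σ|) with hα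
  have hα0 : 0 ≤ α := by positivity
  have hint : Integrable (fun y : ℝ => Real.exp (8 * (α * (1 + |y|)))) (gaussianReal 0 1) := by
    have h := (integrable_exp_mul_abs (X := id) (t := 8 * α)
      (integrable_exp_mul_gaussianReal (μ := 0) (v := 1) _)
      (integrable_exp_mul_gaussianReal (μ := 0) (v := 1) _)).const_mul (Real.exp (8 * α))
    refine h.congr (Eventually.of_forall fun y => ?_)
    simp only [id]
    rw [← Real.exp_add]; ring_nf
  refine ⟨∫ y, Real.exp (8 * (α * (1 + |y|))) ∂(gaussianReal 0 1),
    integral_nonneg fun _ => (Real.exp_pos _).le, fun s t hst hle => ?_⟩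
  set h : ℝ := (t : ℝ) - s with hh
  have hh0 : 0 ≤ h := sub_nonneg.2 (by exact_mod_cast hst)
  have hlaw : gaussianReal 0 (t - s) = (gaussianReal 0 1).map (fun y => √h * y) := by
    rw [gaussianReal_map_const_mul, mul_zero, mul_one]
    congr 1
    ext
    rw [NNReal.coe_sub hst]
    exact (Real.sq_sqrt hh0).symm
  let φ : ℝ → ℝ := fun y => ‖Complex.exp (z * ((c * h + σ * y : ℝ) : ℂ)) - 1‖ ^ 4
  have hφ : Measurable φ := by fun_prop
  have hbound : ∀ y : ℝ, φ (√h * y) ≤ h ^ 2 * Real.exp (8 * (α * (1 + |y|))) := by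
    intro y
    refine norm_exp_sub_one_pow_four_le hα0 hh0 hle ?_
    rw [norm_mul, Complex.norm_real, Real.norm_eq_abs]
    have h1 : h ≤ √h := by
      calc h = √h * √h := (Real.mul_self_sqrt hh0).symm
        _ ≤ 1 * √h := by gcongr; exact Real.sqrt_le_one.2 hle
        _ = √h := one_mul _
    calc ‖z‖ * |c * h + σ * (√h * y)| ≤ ‖z‖ * (|c| * √h + |σ| * (√h * |y|)) := by
          gcongr
          refine (abs_add_le _ _).trans ?_
          rw [abs_mul, abs_mul, abs_mul, abs_of_nonneg hh0, abs_of_nonneg (Real.sqrt_nonneg h)]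
          gcongr
      _ = √h * (‖z‖ * (|c| + |σ| * |y|)) := by ring
      _ ≤ √h * (‖z‖ * ((|c| + |σ|) * (1 + |y|))) := by
          gcongr
          nlinarith [abs_nonneg c, abs_nonneg σ, abs_nonneg y,
            mul_nonneg (abs_nonneg c) (abs_nonneg y)]
      _ = √h * (α * (1 + |y|)) := by rw [hα]; ring
  have hφint : Integrable (fun y => φ (√h * y)) (gaussianReal 0 1) :=
    (hint.const_mul (h ^ 2)).mono' (by fun_prop) (Eventually.of_forall fun y => by
      rw [Real.norm_of_nonneg (by positivity)]; exact hbound y)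
  have hl := hW.hasLaw_increment hst
  have hfun : (fun x => ‖stepFactor W z c σ s t x - 1‖ ^ 4) = φ ∘ fun x => W t x - W s x := rfl
  constructor
  · have h1 : Integrable φ (gaussianReal 0 (t - s)) := by
      rw [hlaw]
      exact (integrable_map_measure hφ.aestronglyMeasurable (by fun_prop)).2 hφint
    rw [← hl.map_eq] at h1
    exact h1.comp_aemeasurable hl.aemeasurable
  · rw [hfun, hl.integral_comp hφ.aestronglyMeasurable, hlaw,
      integral_map (by fun_prop) hφ.aestronglyMeasurable, mul_comm, ← integral_const_mul]
    exact integral_mono hφint (hint.const_mul _) hbound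

end GaussianFactor

section Markov

variable {Ω : Type*} {mΩ : MeasurableSpace Ω} {Q : Measure Ω} {F : Filtration ℝ≥0 mΩ}
  {N K : ℕ} {τ : Fin (N + 1) → ℝ≥0} {A : Fin N → Matrix (Fin K) (Fin K) ℝ}
  {Z : ℝ≥0 → Ω → Fin K}

/-- The Markov property for events: the transition probability out of a state is the same on every
event of the past. -/
lemma IsMarkovChain.exists_transition [IsProbabilityMeasure Q] (hZ : IsMarkovChain F Q τ A Z)
    {s t : ℝ≥0} (hst : s ≤ t) (ht : t ≤ τ (Fin.last N)) (i j : Fin K) :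
    ∃ p : ℝ, ∀ B, MeasurableSet[F s] B →
      Q.real (B ∩ ({x | Z s x = i} ∩ {x | Z t x = j})) = p * Q.real (B ∩ {x | Z s x = i}) := by
  have hZs := hZ.adapted s (hst.trans ht)
  obtain ⟨g, -, hg⟩ := (stronglyMeasurable_condExp (μ := Q)
    (f := {x | Z t x = j}.indicator fun _ => (1 : ℝ))
    (m := MeasurableSpace.comap (Z s) inferInstance)).exists_eq_measurable_comp
  have hmk := hZ.markov s t hst ht j
  rw [hg] at hmk
  have hSi : MeasurableSet[F s] {x | Z s x = i} := hZs (measurableSet_singleton i)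
  have hTj : MeasurableSet {x | Z t x = j} := hZ.measurable ht (measurableSet_singleton j)
  have hint : Integrable ({x | Z t x = j}.indicator fun _ => (1 : ℝ)) Q :=
    (integrable_const 1).indicator hTj
  refine ⟨g i, fun B hB => ?_⟩
  have hBS := hB.inter hSi
  have h := setIntegral_condExp (F.le s) hint hBS
  rw [setIntegral_congr_ae (g := fun _ => g i) (F.le s _ hBS) (by
    filter_upwards [hmk] with x hx hxB
    rw [hx, Function.comp_apply, show Z s x = i from hxB.2]), setIntegral_const,
    setIntegral_indicator hTj, setIntegral_const] at h
  simp only [smul_eq_mul, mul_one] at h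
  rw [← Set.inter_assoc, ← h, mul_comm]

/-- The Markov property with the transition rates put in, tested against an arbitrary function of
the past. -/
lemma IsMarkovChain.setIntegral_transition [IsProbabilityMeasure Q]
    (hZ : IsMarkovChain F Q τ A Z) (hτ : Monotone τ) (n : Fin N) (i j : Fin K) {ε : ℝ}
    (hε : 0 < ε) : ∃ δ : ℝ, 0 < δ ∧ ∀ s t : ℝ≥0, τ n.castSucc ≤ s → s ≤ t → t ≤ τ n.succ →
      (t : ℝ) - s < δ → ∃ p : ℝ,
        |p - ((if i = j then 1 else 0) + ((t : ℝ) - s) * A n i j)| ≤ ε * ((t : ℝ) - s) ∧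
        ∀ {E : Type} [NormedAddCommGroup E] [NormedSpace ℝ E] {Y : Ω → E},
          StronglyMeasurable[F s] Y →
          ∫ x in {x | Z s x = i} ∩ {x | Z t x = j}, Y x ∂Q = p • ∫ x in {x | Z s x = i}, Y x ∂Q := by
  obtain ⟨δ, hδ0, hδ⟩ := hZ.rates n i j ε hε
  refine ⟨δ, hδ0, fun s t hs hst ht hlt => ?_⟩
  have h0 : (0 : ℝ) ≤ (t : ℝ) - s := sub_nonneg.2 (by exact_mod_cast hst)
  have htT : t ≤ τ (Fin.last N) := ht.trans (hτ (Fin.le_last _))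
  have hr := hδ s t hs hst ht hlt
  rcases eq_or_ne (Q.real {x | Z s x = i}) 0 with hz | hz
  · refine ⟨_, (by rw [sub_self, abs_zero]; positivity :
      |((if i = j then 1 else 0) + ((t : ℝ) - s) * A n i j) - _| ≤ _), fun {E} _ _ {Y} _ => ?_⟩
    have h1 : Q {x | Z s x = i} = 0 := (measureReal_eq_zero_iff (measure_ne_top _ _)).1 hz
    rw [Measure.restrict_eq_zero.2 h1,
      Measure.restrict_eq_zero.2 (measure_mono_null Set.inter_subset_left h1)]
    simp
  · obtain ⟨p, hp⟩ := hZ.exists_transition hst htT i j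
    have hpos : 0 < Q.real {x | Z s x = i} := lt_of_le_of_ne measureReal_nonneg (Ne.symm hz)
    have hu := hp Set.univ MeasurableSet.univ
    rw [Set.univ_inter, Set.univ_inter] at hu
    have hp0 : 0 ≤ p := by
      by_contra hneg
      have := mul_neg_of_neg_of_pos (not_le.1 hneg) hpos
      rw [← hu] at this
      exact absurd measureReal_nonneg (not_le.2 this)
    refine ⟨p, ?_, fun {E} _ _ {Y} hY => ?_⟩
    · have hset : {x | Z s x = i ∧ Z t x = j} = {x | Z s x = i} ∩ {x | Z t x = j} := rfl
      rw [hset, hu, mul_comm p, ← mul_sub, abs_mul, abs_of_pos hpos, mul_comm] at hr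
      exact le_of_mul_le_mul_right hr hpos
    · have hmeas : (Q.restrict ({x | Z s x = i} ∩ {x | Z t x = j})).trim (F.le s)
          = (ENNReal.ofReal p • Q.restrict {x | Z s x = i}).trim (F.le s) := by
        refine @Measure.ext _ (F s) _ _ fun B hB => ?_
        rw [trim_measurableSet_eq _ hB, trim_measurableSet_eq _ hB, Measure.smul_apply,
          Measure.restrict_apply (F.le s _ hB), Measure.restrict_apply (F.le s _ hB), smul_eq_mul,
          ← ofReal_measureReal, hp B hB, ENNReal.ofReal_mul hp0, ofReal_measureReal]
      rw [integral_trim (F.le s) hY, hmeas, ← integral_trim (F.le s) hY, integral_smul_measure,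
        ENNReal.toReal_ofReal hp0]

end Markov

section OneStep

variable {Ω : Type*} {mΩ : MeasurableSpace Ω} {Q : Measure Ω} {F : Filtration ℝ≥0 mΩ}
  {W : ℝ≥0 → Ω → ℝ} {N K : ℕ} {τ : Fin (N + 1) → ℝ≥0} {A : Fin N → Matrix (Fin K) (Fin K) ℝ}
  {Z : ℝ≥0 → Ω → Fin K}

/-- The exponent `z c + z² σ² / 2` of the moment generating function of `c t + σ W_t`. -/
noncomputable def gaussExponent (z : ℂ) (c σ : ℝ) : ℂ := z * c + z ^ 2 * σ ^ 2 / 2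

/-- The generator `A` perturbed on the diagonal by the exponents `κ`: the infinitesimal generator of
the semigroup `v ↦ 𝔼[exp (z X_t) v(Z_t)]`. -/
noncomputable def perturbedGenerator (A : Matrix (Fin K) (Fin K) ℝ) (κ : Fin K → ℂ) :
    Matrix (Fin K) (Fin K) ℂ :=
  A.map (fun r => (r : ℂ)) + Matrix.diagonal κ

/-- Splitting off an independent step factor from an event of the past. -/
lemma IsBrownianRel.setIntegral_mul_stepFactor (hW : IsBrownianRel F Q W) {s t : ℝ≥0}
    (hst : s ≤ t) (z : ℂ) (c σ : ℝ) {S : Set Ω} (hS : MeasurableSet[F s] S) {Y : Ω → ℂ}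
    (hY : Measurable[F s] Y) :
    ∫ x in S, Y x * stepFactor W z c σ s t x ∂Q
      = (∫ x in S, Y x ∂Q) * Complex.exp (((t : ℝ) - s : ℝ) * gaussExponent z c σ) := by
  have hYS : Measurable[F s] (S.indicator Y) := hY.indicator hS
  have h := (hW.indepFun_stepFactor hst z c σ hYS).integral_mul_eq_mul_integral
    (hYS.mono (F.le s) le_rfl).aestronglyMeasurable
    (hW.measurable_stepFactor z c σ s t).aestronglyMeasurable
  rw [hW.integral_stepFactor hst, integral_indicator (F.le s _ hS)] at h
  rw [gaussExponent, ← h, ← integral_indicator (F.le s _ hS)]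
  refine integral_congr_ae (Eventually.of_forall fun x => ?_)
  simp only [Set.indicator, Pi.mul_apply]
  split_ifs <;> simp

lemma IsBrownianRel.integrable_mul_stepFactor (hW : IsBrownianRel F Q W) {s t : ℝ≥0}
    (hst : s ≤ t) (z : ℂ) (c σ : ℝ) {Y : Ω → ℂ} (hY : Measurable[F s] Y)
    (hYi : Integrable Y Q) : Integrable (fun x => Y x * stepFactor W z c σ s t x) Q :=
  (hW.indepFun_stepFactor hst z c σ hY).integrable_mul hYi (hW.integrable_stepFactor hst z c σ)

/-- A Young inequality: it trades the first power on a rare event for the fourth power. -/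
lemma le_add_pow_four_div {x η : ℝ} (hx : 0 ≤ x) (hη : 0 < η) : x ≤ η + x ^ 4 / η ^ 3 := by
  rcases le_total x η with h | h
  · have : 0 ≤ x ^ 4 / η ^ 3 := by positivity
    linarith
  · have h3 : η ^ 3 ≤ x ^ 3 := by gcongr
    have : x ≤ x ^ 4 / η ^ 3 := by
      rw [le_div_iff₀ (by positivity)]
      calc x * η ^ 3 ≤ x * x ^ 3 := by gcongr
        _ = x ^ 4 := by ring
    linarith

/-- On a jump from `i` to `j`, the step factor may be replaced by `1`: no independence of the jump
and the Brownian increment is needed, since a jump has probability `O(h)` and the fourth moment of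
`stepFactor - 1` is `O(h²)`. -/
lemma IsMarkovChain.setIntegral_jump [IsProbabilityMeasure Q] (hZ : IsMarkovChain F Q τ A Z)
    (hτ : Monotone τ) (hW : IsBrownianRel F Q W) (n : Fin N) (z : ℂ) (c σ : ℝ) {i j : Fin K}
    (hij : i ≠ j) {ε : ℝ} (hε : 0 < ε) : ∃ δ : ℝ, 0 < δ ∧ ∀ s t : ℝ≥0, τ n.castSucc ≤ s →
      s ≤ t → t ≤ τ n.succ → (t : ℝ) - s < δ → ∀ Y : Ω → ℂ, Measurable[F s] Y → Integrable Y Q →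
      ‖∫ x in {x | Z s x = i} ∩ {x | Z t x = j}, Y x * stepFactor W z c σ s t x ∂Q
        - ((t : ℝ) - s : ℝ) * A n i j * ∫ x in {x | Z s x = i}, Y x ∂Q‖
        ≤ ε * ((t : ℝ) - s) * ∫ x, ‖Y x‖ ∂Q := by
  obtain ⟨C, hC0, hC⟩ := hW.integral_stepFactor_sub_one_le z c σ
  set ε₁ := min (ε / 3) 1 with hε₁
  have hε₁0 : 0 < ε₁ := by positivity
  obtain ⟨δ₁, hδ₁0, hδ₁⟩ := hZ.setIntegral_transition hτ n i j hε₁0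
  set η := ε / (3 * (|A n i j| + 1)) with hη
  have hη0 : 0 < η := by positivity
  set δ₂ := ε / 3 * η ^ 3 / (C + 1) with hδ₂
  have hδ₂0 : 0 < δ₂ := by positivity
  refine ⟨min δ₁ (min δ₂ 1), by positivity, fun s t hs hst ht hlt Y hY hYi => ?_⟩
  have hh0 : (0 : ℝ) ≤ (t : ℝ) - s := sub_nonneg.2 (by exact_mod_cast hst)
  obtain ⟨p, hp, hpY⟩ := hδ₁ s t hs hst ht (hlt.trans_le (min_le_left _ _))
  have hlt₂ : (t : ℝ) - s < δ₂ := hlt.trans_le ((min_le_right _ _).trans (min_le_left _ _))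
  have hlt1 : (t : ℝ) - s < 1 := hlt.trans_le ((min_le_right _ _).trans (min_le_right _ _))
  set h : ℝ := (t : ℝ) - s with hh
  rw [if_neg hij, zero_add] at hp
  obtain ⟨hGi, hG⟩ := hC s t hst hlt1.le
  set G := stepFactor W z c σ s t with hGdef
  set S : Set Ω := {x | Z s x = i} with hS
  set T : Set Ω := {x | Z t x = j} with hT
  have htT : t ≤ τ (Fin.last N) := ht.trans (hτ (Fin.le_last _))
  have hSm : MeasurableSet[F s] S := hZ.adapted s (hst.trans htT) (measurableSet_singleton i)
  have hYn : Measurable[F s] fun x => ‖Y x‖ :=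
    measurable_norm.comp hY
  have hYG : Integrable (fun x => Y x * G x) Q := hW.integrable_mul_stepFactor hst z c σ hY hYi
  -- the fourth moment of `G - 1` is independent of the past
  have hind : IndepFun (fun x => ‖Y x‖) (fun x => ‖G x - 1‖ ^ 4) Q :=
    (hW.indepFun_stepFactor hst z c σ hYn).comp measurable_id
      (ψ := fun g : ℂ => ‖g - 1‖ ^ 4) (by fun_prop)
  have hY4 : Integrable (fun x => ‖Y x‖ * ‖G x - 1‖ ^ 4) Q := hind.integrable_mul hYi.norm hGi
  have hY4le : ∫ x, ‖Y x‖ * ‖G x - 1‖ ^ 4 ∂Q ≤ (∫ x, ‖Y x‖ ∂Q) * (C * h ^ 2) := by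
    have := hind.integral_mul_eq_mul_integral hYi.norm.1 hGi.1
    simp only [Pi.mul_apply] at this
    rw [this]
    exact mul_le_mul_of_nonneg_left hG (integral_nonneg fun _ => norm_nonneg _)
  set I := ∫ x, ‖Y x‖ ∂Q with hI
  have hI0 : 0 ≤ I := integral_nonneg fun _ => norm_nonneg _
  have hIS : ∫ x in S, ‖Y x‖ ∂Q ≤ I :=
    setIntegral_le_integral hYi.norm (Eventually.of_forall fun _ => norm_nonneg _)
  have hIS0 : 0 ≤ ∫ x in S, ‖Y x‖ ∂Q := integral_nonneg fun _ => norm_nonneg _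
  have hYS : ‖∫ x in S, Y x ∂Q‖ ≤ I := (norm_integral_le_integral_norm _).trans hIS
  have e1 : ∫ x in S ∩ T, Y x ∂Q = (p : ℂ) * ∫ x in S, Y x ∂Q := by
    rw [hpY hY.stronglyMeasurable, Complex.real_smul]
  have e2 : ∫ x in S ∩ T, ‖Y x‖ ∂Q = p * ∫ x in S, ‖Y x‖ ∂Q := hpY hYn.stronglyMeasurable
  have hpabs : |p| ≤ (|A n i j| + 1) * h := by
    have h1 : |p| ≤ |p - h * A n i j| + |h * A n i j| := by
      simpa using abs_add_le (p - h * A n i j) (h * A n i j)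
    rw [abs_mul, abs_of_nonneg hh0] at h1
    nlinarith [min_le_right (ε / 3) 1]
  -- replace the step factor by `1`
  have hrepl : ‖∫ x in S ∩ T, Y x * (G x - 1) ∂Q‖ ≤ (2 * ε / 3) * h * I := by
    calc ‖∫ x in S ∩ T, Y x * (G x - 1) ∂Q‖
        ≤ ∫ x in S ∩ T, ‖Y x * (G x - 1)‖ ∂Q := norm_integral_le_integral_norm _
      _ ≤ ∫ x in S ∩ T, (η * ‖Y x‖ + (η ^ 3)⁻¹ * (‖Y x‖ * ‖G x - 1‖ ^ 4)) ∂Q := by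
          refine setIntegral_mono ?_ ?_ fun x => ?_
          · have : (fun x => ‖Y x * (G x - 1)‖) = fun x => ‖Y x * G x - Y x‖ := by
              ext x; rw [mul_sub, mul_one]
            rw [this]
            exact (hYG.sub hYi).norm.integrableOn
          · exact ((hYi.norm.const_mul _).add (hY4.const_mul _)).integrableOn
          · simp only
            rw [norm_mul]
            have := mul_le_mul_of_nonneg_left
              (le_add_pow_four_div (norm_nonneg (G x - 1)) hη0) (norm_nonneg (Y x))
            rw [div_eq_mul_inv] at this
            linarith
      _ = η * (p * ∫ x in S, ‖Y x‖ ∂Q)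
          + (η ^ 3)⁻¹ * ∫ x in S ∩ T, ‖Y x‖ * ‖G x - 1‖ ^ 4 ∂Q := by
          rw [integral_add (hYi.norm.const_mul _).integrableOn (hY4.const_mul _).integrableOn,
            integral_const_mul, integral_const_mul, e2]
      _ ≤ η * ((|A n i j| + 1) * h * I) + (η ^ 3)⁻¹ * (I * (C * h ^ 2)) := by
          gcongr
          · exact (le_abs_self p).trans hpabs
          · exact (setIntegral_le_integral hY4
              (Eventually.of_forall fun _ => by positivity)).trans hY4le
      _ ≤ ε / 3 * h * I + ε / 3 * h * I := by
          have h1 : η * ((|A n i j| + 1) * h * I) = ε / 3 * h * I := by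
            rw [hη]; field_simp
          have h2 : (η ^ 3)⁻¹ * (I * (C * h ^ 2)) ≤ ε / 3 * h * I := by
            have h3 : h * (C + 1) ≤ ε / 3 * η ^ 3 := by
              rw [← le_div_iff₀ (by positivity)]; exact hlt₂.le
            have h4 : C * h ≤ ε / 3 * η ^ 3 := by nlinarith
            calc (η ^ 3)⁻¹ * (I * (C * h ^ 2)) = (η ^ 3)⁻¹ * (I * h * (C * h)) := by ring
              _ ≤ (η ^ 3)⁻¹ * (I * h * (ε / 3 * η ^ 3)) := by gcongr
              _ = ε / 3 * h * I := by field_simp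
          rw [h1]; gcongr
      _ = _ := by ring
  have hsplit : ∫ x in S ∩ T, Y x * G x ∂Q - (h : ℂ) * A n i j * ∫ x in S, Y x ∂Q
      = ∫ x in S ∩ T, Y x * (G x - 1) ∂Q
        + ((p - h * A n i j : ℝ) : ℂ) * ∫ x in S, Y x ∂Q := by
    have : ∫ x in S ∩ T, Y x * (G x - 1) ∂Q
        = ∫ x in S ∩ T, Y x * G x ∂Q - ∫ x in S ∩ T, Y x ∂Q := by
      rw [← integral_sub hYG.integrableOn hYi.integrableOn]
      simp only [mul_sub, mul_one]
    rw [this, e1]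
    push_cast
    ring
  rw [hsplit]
  refine (norm_add_le _ _).trans ?_
  rw [norm_mul, Complex.norm_real, Real.norm_eq_abs]
  calc _ ≤ (2 * ε / 3) * h * I + (ε / 3 * h) * I := by
        gcongr
        exact hp.trans (mul_le_mul_of_nonneg_right (min_le_left _ _) hh0)
    _ = _ := by ring

/-- The first-order expansion of one step: transitions happen to first order according to
`1 + h (A + diag κ)`. -/
lemma IsMarkovChain.setIntegral_step_one_add [IsProbabilityMeasure Q]
    (hZ : IsMarkovChain F Q τ A Z) (hτ : Monotone τ) (hW : IsBrownianRel F Q W) (n : Fin N)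
    (hA : IsGenerator (A n)) (z : ℂ) (c σ : Fin K → ℝ) (i j : Fin K) {ε : ℝ} (hε : 0 < ε) :
    ∃ δ : ℝ, 0 < δ ∧ ∀ s t : ℝ≥0, τ n.castSucc ≤ s →
      s ≤ t → t ≤ τ n.succ → (t : ℝ) - s < δ → ∀ Y : Ω → ℂ, Measurable[F s] Y → Integrable Y Q →
      ‖∫ x in {x | Z s x = i} ∩ {x | Z t x = j}, Y x * stepFactor W z (c i) (σ i) s t x ∂Q
        - ((1 : Matrix (Fin K) (Fin K) ℂ) i j + ((t : ℝ) - s : ℝ)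
          * perturbedGenerator (A n) (fun k => gaussExponent z (c k) (σ k)) i j)
          * ∫ x in {x | Z s x = i}, Y x ∂Q‖
        ≤ ε * ((t : ℝ) - s) * ∫ x, ‖Y x‖ ∂Q := by
  rcases ne_or_eq i j with hij | rfl
  · obtain ⟨δ, hδ0, hδ⟩ := hZ.setIntegral_jump hτ hW n z (c i) (σ i) hij hε
    refine ⟨δ, hδ0, fun s t hs hst ht hlt Y hY hYi => ?_⟩
    simpa [perturbedGenerator, Matrix.one_apply_ne hij, Matrix.diagonal_apply_ne _ hij] using
      hδ s t hs hst ht hlt Y hY hYi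
  set κ := gaussExponent z (c i) (σ i) with hκ
  set ε₁ := ε / (2 * (K + 1)) with hε₁
  have hε₁0 : 0 < ε₁ := by positivity
  have hjump : ∀ j, ∃ δ : ℝ, 0 < δ ∧ (i ≠ j → ∀ s t : ℝ≥0, τ n.castSucc ≤ s →
      s ≤ t → t ≤ τ n.succ → (t : ℝ) - s < δ → ∀ Y : Ω → ℂ, Measurable[F s] Y → Integrable Y Q →
      ‖∫ x in {x | Z s x = i} ∩ {x | Z t x = j}, Y x * stepFactor W z (c i) (σ i) s t x ∂Q
        - ((t : ℝ) - s : ℝ) * A n i j * ∫ x in {x | Z s x = i}, Y x ∂Q‖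
        ≤ ε₁ * ((t : ℝ) - s) * ∫ x, ‖Y x‖ ∂Q) := by
    intro j
    by_cases hij : i = j
    · exact ⟨1, one_pos, fun h => absurd hij h⟩
    · obtain ⟨δ, hδ0, hδ⟩ := hZ.setIntegral_jump hτ hW n z (c i) (σ i) hij hε₁0
      exact ⟨δ, hδ0, fun _ => hδ⟩
  choose δ hδ0 hδ using hjump
  obtain ⟨k₀, hk₀⟩ := haveI : Nonempty (Fin K) := ⟨i⟩; Finite.exists_min δ
  set δ₂ := min (1 / (‖κ‖ + 1)) (ε / 2 / (‖κ‖ ^ 2 + 1)) with hδ₂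
  have hδ₂0 : 0 < δ₂ := by positivity
  refine ⟨min (δ k₀) δ₂, lt_min (hδ0 _) hδ₂0, fun s t hs hst ht hlt Y hY hYi => ?_⟩
  have hh0 : (0 : ℝ) ≤ (t : ℝ) - s := sub_nonneg.2 (by exact_mod_cast hst)
  have hltδ : ∀ j, (t : ℝ) - s < δ j := fun j =>
    (hlt.trans_le (min_le_left _ _)).trans_le (hk₀ j)
  have hlt2 : (t : ℝ) - s < δ₂ := hlt.trans_le (min_le_right _ _)
  have hδ' := fun j hij => hδ j hij s t hs hst ht (hltδ j) Y hY hYi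
  have htT : t ≤ τ (Fin.last N) := ht.trans (hτ (Fin.le_last _))
  have hSm : MeasurableSet[F s] {x | Z s x = i} :=
    hZ.adapted s (hst.trans htT) (measurableSet_singleton i)
  have hfac := hW.setIntegral_mul_stepFactor hst z (c i) (σ i) hSm hY
  have hYG := hW.integrable_mul_stepFactor hst z (c i) (σ i) hY hYi
  set h : ℝ := (t : ℝ) - s with hh
  set G := stepFactor W z (c i) (σ i) s t with hG
  set S : Set Ω := {x | Z s x = i} with hS
  set y := ∫ x in S, Y x ∂Q with hy
  set I := ∫ x, ‖Y x‖ ∂Q with hI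
  have hI0 : 0 ≤ I := integral_nonneg fun _ => norm_nonneg _
  have hyI : ‖y‖ ≤ I := (norm_integral_le_integral_norm _).trans
    (setIntegral_le_integral hYi.norm (Eventually.of_forall fun _ => norm_nonneg _))
  have htot : ∑ j, ∫ x in S ∩ {x | Z t x = j}, Y x * G x ∂Q = ∫ x in S, Y x * G x ∂Q := by
    rw [← integral_iUnion_fintype (s := fun j => S ∩ {x | Z t x = j}) (fun j => (F.le s _ hSm).inter
      (hZ.measurable htT (measurableSet_singleton j))) ?_ (fun j => hYG.integrableOn)]
    · congr 2
      ext x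
      simp
    · intro j k hjk
      refine Set.disjoint_left.2 fun x hx hx' => hjk ?_
      exact hx.2.symm.trans hx'.2
  have hrow : (A n i i : ℂ) = -∑ j ∈ Finset.univ.erase i, (A n i j : ℂ) := by
    have := hA.row_sum i
    rw [← Finset.add_sum_erase _ _ (Finset.mem_univ i)] at this
    rw [eq_neg_iff_add_eq_zero]
    exact_mod_cast this
  rw [← Finset.add_sum_erase _ _ (Finset.mem_univ i), hfac] at htot
  -- staying in `i` is the complement of the jumps
  have hdiag : ∫ x in S ∩ {x | Z t x = i}, Y x * G x ∂Q
      - ((1 : Matrix (Fin K) (Fin K) ℂ) i i + (h : ℂ)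
          * perturbedGenerator (A n) (fun k => gaussExponent z (c k) (σ k)) i i) * y
      = (Complex.exp (h * κ) - 1 - h * κ) * y
        - ∑ j ∈ Finset.univ.erase i, (∫ x in S ∩ {x | Z t x = j}, Y x * G x ∂Q
          - (h : ℂ) * A n i j * y) := by
    rw [eq_sub_of_add_eq htot, Finset.sum_sub_distrib, ← Finset.sum_mul, ← Finset.mul_sum]
    simp only [perturbedGenerator, Matrix.one_apply_eq, Matrix.add_apply, Matrix.map_apply,
      Matrix.diagonal_apply_eq]
    rw [hrow]
    ring
  rw [hdiag]
  refine (norm_sub_le _ _).trans ?_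
  have hhκ : h * ‖κ‖ ≤ 1 := by
    have := (hlt2.trans_le (min_le_left _ _)).le
    rw [le_div_iff₀ (by positivity)] at this
    nlinarith
  have h1 : ‖(Complex.exp (h * κ) - 1 - h * κ) * y‖ ≤ ε / 2 * h * I := by
    rw [norm_mul]
    refine mul_le_mul ?_ hyI (norm_nonneg _) (by positivity)
    have hn : ‖(h : ℂ) * κ‖ = h * ‖κ‖ := by
      rw [norm_mul, Complex.norm_real, Real.norm_of_nonneg hh0]
    refine (Complex.norm_exp_sub_one_sub_id_le (by rw [hn]; exact hhκ)).trans ?_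
    rw [hn]
    have := (hlt2.trans_le (min_le_right _ _)).le
    rw [le_div_iff₀ (by positivity)] at this
    nlinarith
  have h2 : ‖∑ j ∈ Finset.univ.erase i, (∫ x in S ∩ {x | Z t x = j}, Y x * G x ∂Q
          - (h : ℂ) * A n i j * y)‖ ≤ ε / 2 * h * I := by
    calc _ ≤ ∑ j ∈ Finset.univ.erase i, ε₁ * h * I :=
          norm_sum_le_of_le _ fun j hj => hδ' j (Finset.ne_of_mem_erase hj).symm
      _ ≤ ∑ j : Fin K, ε₁ * h * I :=
          Finset.sum_le_sum_of_subset_of_nonneg (Finset.erase_subset _ _)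
            fun _ _ _ => by positivity
      _ = (K * ε₁) * (h * I) := by
          rw [Finset.sum_const, Finset.card_univ, Fintype.card_fin, nsmul_eq_mul]; ring
      _ ≤ (ε / 2) * (h * I) := by
          gcongr
          rw [hε₁, mul_div_assoc', div_le_div_iff₀ (by positivity) (by positivity)]
          nlinarith
      _ = _ := by ring
  linarith

/-- The matrix exponential to first order, entry by entry. -/
lemma exp_smul_apply_sub_le (M : Matrix (Fin K) (Fin K) ℂ) (i j : Fin K) {ε : ℝ} (hε : 0 < ε) :
    ∃ δ : ℝ, 0 < δ ∧ ∀ h : ℝ, 0 ≤ h → h < δ →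
      ‖NormedSpace.exp (h • M) i j - ((1 : Matrix (Fin K) (Fin K) ℂ) i j + h * M i j)‖ ≤ ε * h := by
  let : NormedRing (Matrix (Fin K) (Fin K) ℂ) := Matrix.linftyOpNormedRing
  let : NormedAlgebra ℝ (Matrix (Fin K) (Fin K) ℂ) := Matrix.linftyOpNormedAlgebra
  have hd := hasDerivAt_exp_smul_const (𝕂 := ℝ) M 0
  rw [zero_smul, NormedSpace.exp_zero, one_mul] at hd
  let L : Matrix (Fin K) (Fin K) ℂ →L[ℝ] ℂ :=
    LinearMap.toContinuousLinearMap
      { toFun := fun B => B i j, map_add' := fun _ _ => rfl, map_smul' := fun _ _ => rfl }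
  have hd' : HasDerivAt (fun h : ℝ => NormedSpace.exp (h • M) i j) (M i j) 0 :=
    L.hasFDerivAt.comp_hasDerivAt (0 : ℝ) hd
  have ho := (hasDerivAt_iff_isLittleO.1 hd').def hε
  obtain ⟨δ, hδ0, hδ⟩ := Metric.eventually_nhds_iff.1 ho
  refine ⟨δ, hδ0, fun h hh0 hhδ => ?_⟩
  have := hδ (y := h) (by rwa [Real.dist_eq, sub_zero, abs_of_nonneg hh0])
  rw [zero_smul, NormedSpace.exp_zero, sub_zero, Real.norm_of_nonneg hh0, sub_sub,
    Complex.real_smul] at this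
  exact this

/-- Over a short step from `s` to `t`, the vector `i ↦ 𝔼[Y; Z_s = i]` evolves by the matrix
exponential of the perturbed generator, up to an error `o(t - s)` relative to `𝔼|Y|`. -/
theorem IsMarkovChain.setIntegral_step [IsProbabilityMeasure Q] (hZ : IsMarkovChain F Q τ A Z)
    (hτ : Monotone τ) (hW : IsBrownianRel F Q W) (n : Fin N) (hA : IsGenerator (A n)) (z : ℂ)
    (c σ : Fin K → ℝ) {ε : ℝ} (hε : 0 < ε) :
    ∃ δ : ℝ, 0 < δ ∧ ∀ s t : ℝ≥0, τ n.castSucc ≤ s → s ≤ t → t ≤ τ n.succ → (t : ℝ) - s < δ →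
      ∀ Y : Ω → ℂ, Measurable[F s] Y → Integrable Y Q → ∀ i j,
      ‖∫ x in {x | Z s x = i} ∩ {x | Z t x = j}, Y x * stepFactor W z (c i) (σ i) s t x ∂Q
        - NormedSpace.exp (((t : ℝ) - s)
          • perturbedGenerator (A n) (fun k => gaussExponent z (c k) (σ k))) i j
          * ∫ x in {x | Z s x = i}, Y x ∂Q‖
        ≤ ε * ((t : ℝ) - s) * ∫ x, ‖Y x‖ ∂Q := by
  set M := perturbedGenerator (A n) (fun k => gaussExponent z (c k) (σ k)) with hM
  choose δ₁ hδ₁0 hδ₁ using fun i j =>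
    hZ.setIntegral_step_one_add hτ hW n hA z c σ i j (half_pos hε)
  choose δ₂ hδ₂0 hδ₂ using fun i j => exp_smul_apply_sub_le M i j (half_pos hε)
  obtain ⟨d, hd0, hd⟩ : ∃ d : ℝ, 0 < d ∧ ∀ i j, d ≤ δ₁ i j ∧ d ≤ δ₂ i j := by
    refine (isEmpty_or_nonempty (Fin K × Fin K)).elim
      (fun _ => ⟨1, one_pos, fun i j => isEmptyElim (i, j)⟩) fun _ => ?_
    obtain ⟨p, hp⟩ := Finite.exists_min fun p : Fin K × Fin K => min (δ₁ p.1 p.2) (δ₂ p.1 p.2)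
    exact ⟨min (δ₁ p.1 p.2) (δ₂ p.1 p.2), lt_min (hδ₁0 _ _) (hδ₂0 _ _), fun i j =>
      ⟨(hp (i, j)).trans (min_le_left _ _), (hp (i, j)).trans (min_le_right _ _)⟩⟩
  refine ⟨d, hd0, fun s t hs hst ht hlt Y hY hYi i j => ?_⟩
  have hh0 : (0 : ℝ) ≤ (t : ℝ) - s := sub_nonneg.2 (by exact_mod_cast hst)
  have h1 := hδ₁ i j s t hs hst ht (hlt.trans_le (hd i j).1) Y hY hYi
  have h2 := hδ₂ i j _ hh0 (hlt.trans_le (hd i j).2)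
  set y := ∫ x in {x | Z s x = i}, Y x ∂Q with hy
  have hyI : ‖y‖ ≤ ∫ x, ‖Y x‖ ∂Q := (norm_integral_le_integral_norm _).trans
    (setIntegral_le_integral hYi.norm (Eventually.of_forall fun _ => norm_nonneg _))
  have h3 := mul_le_mul h2 hyI (norm_nonneg _) (by positivity)
  rw [← norm_mul] at h3
  rw [← sub_add_sub_cancel _ (((1 : Matrix (Fin K) (Fin K) ℂ) i j
    + ((t : ℝ) - s : ℝ) * M i j) * y)]
  refine (norm_add_le _ _).trans ?_
  rw [← sub_mul, norm_mul, norm_sub_rev (_ + _), ← norm_mul]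
  linarith

end OneStep

/-! ### From one step to one period -/

section Period

variable {Ω : Type*} {mΩ : MeasurableSpace Ω} {Q : Measure Ω} {F : Filtration ℝ≥0 mΩ}
  {W : ℝ≥0 → Ω → ℝ} {N K : ℕ} {τ : Fin (N + 1) → ℝ≥0} {A : Fin N → Matrix (Fin K) (Fin K) ℝ}
  {Z : ℝ≥0 → Ω → Fin K}

lemma exists_norm_exp_smul_apply_le (M : Matrix (Fin K) (Fin K) ℂ) (T : ℝ) :
    ∃ D : ℝ, 0 ≤ D ∧ ∀ s ∈ Set.Icc 0 T, ∀ i j, ‖NormedSpace.exp (s • M) i j‖ ≤ D := by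
  let : NormedRing (Matrix (Fin K) (Fin K) ℂ) := Matrix.linftyOpNormedRing
  let : NormedAlgebra ℝ (Matrix (Fin K) (Fin K) ℂ) := Matrix.linftyOpNormedAlgebra
  have hc : Continuous fun s : ℝ => NormedSpace.exp (s • M) :=
    continuous_iff_continuousAt.2 fun s =>
      (hasDerivAt_exp_smul_const (𝕂 := ℝ) M s).continuousAt
  choose D hD using fun i j => (isCompact_Icc (a := (0 : ℝ)) (b := T)).exists_bound_of_continuousOn
    (hc.matrix_elem i j).continuousOn
  refine ⟨∑ i, ∑ j, |D i j|, by positivity, fun s hs i j => ?_⟩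
  calc _ ≤ D i j := hD i j s hs
    _ ≤ |D i j| := le_abs_self _
    _ ≤ ∑ j, |D i j| := Finset.single_le_sum (f := fun j => |D i j|)
        (fun _ _ => abs_nonneg _) (Finset.mem_univ j)
    _ ≤ _ := Finset.single_le_sum (f := fun i => ∑ j, |D i j|)
        (fun _ _ => by positivity) (Finset.mem_univ i)

lemma exp_add_smul (M : Matrix (Fin K) (Fin K) ℂ) (s t : ℝ) :
    NormedSpace.exp ((s + t) • M) = NormedSpace.exp (s • M) * NormedSpace.exp (t • M) := by
  rw [add_smul, Matrix.exp_add_of_commute]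
  exact (Commute.refl M).smul_left s |>.smul_right t

/-- Local errors of a scheme for `v' = v M` add up: propagating each of them to the end by the
semigroup costs a bounded factor. -/
lemma norm_sub_vecMul_exp_le (M : Matrix (Fin K) (Fin K) ℂ) {v : ℕ → Fin K → ℂ} {m : ℕ} {h ρ D : ℝ}
    (hh : 0 ≤ h) (hD : ∀ s ∈ Set.Icc 0 (m * h), ∀ i j, ‖NormedSpace.exp (s • M) i j‖ ≤ D)
    (hv : ∀ k < m, ∀ j,
      ‖v (k + 1) j - Matrix.vecMul (v k) (NormedSpace.exp (h • M)) j‖ ≤ ρ) (j : Fin K) :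
    ‖v m j - Matrix.vecMul (v 0) (NormedSpace.exp ((m * h) • M)) j‖ ≤ m * (K * (ρ * D)) := by
  let f : ℕ → Fin K → ℂ := fun k =>
    Matrix.vecMul (v k) (NormedSpace.exp (((m - k : ℝ) * h) • M))
  have h0 : f 0 = Matrix.vecMul (v 0) (NormedSpace.exp ((m * h) • M)) := by simp [f]
  have hm : f m = v m := by simp [f]
  have hstep : ∀ k < m, ‖f (k + 1) j - f k j‖ ≤ K * (ρ * D) := by
    intro k hk
    have hk' : (k : ℝ) + 1 ≤ m := by exact_mod_cast hk
    have e : f k = Matrix.vecMul (Matrix.vecMul (v k) (NormedSpace.exp (h • M)))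
        (NormedSpace.exp (((m - (k + 1 : ℕ) : ℝ) * h) • M)) := by
      rw [Matrix.vecMul_vecMul, ← exp_add_smul]
      simp only [f]
      congr 3
      push_cast
      ring
    rw [e]
    have e2 : f (k + 1) j - Matrix.vecMul (Matrix.vecMul (v k) (NormedSpace.exp (h • M)))
        (NormedSpace.exp (((m - (k + 1 : ℕ) : ℝ) * h) • M)) j
        = ∑ i, (v (k + 1) i - Matrix.vecMul (v k) (NormedSpace.exp (h • M)) i)
          * NormedSpace.exp (((m - (k + 1 : ℕ) : ℝ) * h) • M) i j := by
      simp only [f, sub_mul, Finset.sum_sub_distrib]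
      rfl
    rw [e2]
    calc _ ≤ ∑ i : Fin K, ρ * D := by
          refine norm_sum_le_of_le _ fun i _ => ?_
          rw [norm_mul]
          refine mul_le_mul (hv k hk i) (hD _ ⟨?_, ?_⟩ i j) (norm_nonneg _)
            ((norm_nonneg _).trans (hv k hk i))
          · refine mul_nonneg ?_ hh
            push_cast
            linarith
          · gcongr
            push_cast
            have : (0 : ℝ) ≤ k := k.cast_nonneg
            linarith
      _ = _ := by rw [Finset.sum_const, Finset.card_univ, Fintype.card_fin, nsmul_eq_mul]
  have htel : v m j - Matrix.vecMul (v 0) (NormedSpace.exp ((m * h) • M)) j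
      = ∑ k ∈ Finset.range m, (f (k + 1) j - f k j) := by
    rw [Finset.sum_range_sub (fun k => f k j), hm, h0]
  rw [htel]
  calc _ ≤ ∑ k ∈ Finset.range m, (K * (ρ * D) : ℝ) :=
        norm_sum_le_of_le _ fun k hk => hstep k (Finset.mem_range.1 hk)
    _ = _ := by rw [Finset.sum_const, Finset.card_range, nsmul_eq_mul]

/-- The factor of one step in which the coefficients are frozen at the current regime. -/
noncomputable def regimeFactor (W : ℝ≥0 → Ω → ℝ) (Z : ℝ≥0 → Ω → Fin K) (z : ℂ) (c σ : Fin K → ℝ)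
    (s t : ℝ≥0) (x : Ω) : ℂ :=
  stepFactor W z (c (Z s x)) (σ (Z s x)) s t x

lemma mul_regimeFactor_eq_sum (z : ℂ) (c σ : Fin K → ℝ) (s t : ℝ≥0) (Y : Ω → ℂ) (x : Ω) :
    Y x * regimeFactor W Z z c σ s t x
      = ∑ i, {x | Z s x = i}.indicator Y x * stepFactor W z (c i) (σ i) s t x := by
  rw [Finset.sum_eq_single (Z s x)]
  · simp [regimeFactor]
  · intro i _ hi
    rw [Set.indicator_of_notMem (by simpa using hi.symm), zero_mul]
  · simp

lemma integrable_mul_regimeFactor (hW : IsBrownianRel F Q W) {s t : ℝ≥0} (hst : s ≤ t)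
    (hZs : Measurable[F s] (Z s)) (z : ℂ) (c σ : Fin K → ℝ) {Y : Ω → ℂ} (hY : Measurable[F s] Y)
    (hYi : Integrable Y Q) : Integrable (fun x => Y x * regimeFactor W Z z c σ s t x) Q := by
  have hSm : ∀ i, MeasurableSet[F s] {x | Z s x = i} := fun i => hZs (measurableSet_singleton i)
  simp only [mul_regimeFactor_eq_sum]
  exact integrable_finsetSum _ fun i _ => hW.integrable_mul_stepFactor hst z (c i) (σ i)
    (hY.indicator (hSm i)) (hYi.indicator (F.le s _ (hSm i)))

/-- One step multiplies the first absolute moment by at most `exp (h Γ)`. -/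
lemma integral_norm_mul_regimeFactor_le (hW : IsBrownianRel F Q W) {s t : ℝ≥0} (hst : s ≤ t)
    (hZs : Measurable[F s] (Z s)) (z : ℂ) (c σ : Fin K → ℝ) {Γ : ℝ}
    (hΓ : ∀ k, z.re * c k + z.re ^ 2 * σ k ^ 2 / 2 ≤ Γ) {Y : Ω → ℂ} (hY : Measurable[F s] Y)
    (hYi : Integrable Y Q) :
    ∫ x, ‖Y x * regimeFactor W Z z c σ s t x‖ ∂Q
      ≤ Real.exp (((t : ℝ) - s) * Γ) * ∫ x, ‖Y x‖ ∂Q := by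
  have hh0 : (0 : ℝ) ≤ (t : ℝ) - s := sub_nonneg.2 (by exact_mod_cast hst)
  have hSm : ∀ i, MeasurableSet[F s] {x | Z s x = i} := fun i => hZs (measurableSet_singleton i)
  have hYm : ∀ i, Measurable[F s] ({x | Z s x = i}.indicator Y) := fun i => hY.indicator (hSm i)
  have hYim : ∀ i, Integrable ({x | Z s x = i}.indicator Y) Q := fun i =>
    hYi.indicator (F.le s _ (hSm i))
  have hprod : ∀ i, Integrable (fun x => {x | Z s x = i}.indicator Y x
      * stepFactor W z (c i) (σ i) s t x) Q := fun i =>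
    hW.integrable_mul_stepFactor hst z (c i) (σ i) (hYm i) (hYim i)
  have hnorm : ∀ i, ∫ x, ‖{x | Z s x = i}.indicator Y x * stepFactor W z (c i) (σ i) s t x‖ ∂Q
      ≤ Real.exp (((t : ℝ) - s) * Γ) * ∫ x, ‖{x | Z s x = i}.indicator Y x‖ ∂Q := by
    intro i
    have hind := ((hW.indepFun_stepFactor hst z (c i) (σ i) (hYm i)).comp measurable_norm
      measurable_norm).integral_mul_eq_mul_integral (hYim i).norm.1
      (hW.integrable_stepFactor hst z (c i) (σ i)).norm.1
    simp only [Pi.mul_apply, Function.comp_apply] at hind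
    simp only [norm_mul]
    rw [hind, hW.integral_norm_stepFactor hst, mul_comm]
    refine mul_le_mul_of_nonneg_right ?_ (integral_nonneg fun _ => norm_nonneg _)
    exact Real.exp_le_exp.2 (mul_le_mul_of_nonneg_left (hΓ i) hh0)
  have hsum : ∀ x, ‖Y x‖ = ∑ i, ‖{x | Z s x = i}.indicator Y x‖ := by
    intro x
    rw [Finset.sum_eq_single (Z s x)]
    · simp
    · intro i _ hi
      rw [Set.indicator_of_notMem (by simpa using hi.symm), norm_zero]
    · simp
  have hint := integrable_mul_regimeFactor hW hst hZs z c σ hY hYi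
  calc ∫ x, ‖Y x * regimeFactor W Z z c σ s t x‖ ∂Q
      ≤ ∫ x, ∑ i, ‖{x | Z s x = i}.indicator Y x * stepFactor W z (c i) (σ i) s t x‖ ∂Q := by
        refine integral_mono hint.norm (integrable_finsetSum _ fun i _ => (hprod i).norm)
          fun x => ?_
        simp only [mul_regimeFactor_eq_sum]
        exact norm_sum_le _ _
    _ = ∑ i, ∫ x, ‖{x | Z s x = i}.indicator Y x * stepFactor W z (c i) (σ i) s t x‖ ∂Q :=
        integral_finsetSum _ fun i _ => (hprod i).norm
    _ ≤ ∑ i, Real.exp (((t : ℝ) - s) * Γ) * ∫ x, ‖{x | Z s x = i}.indicator Y x‖ ∂Q :=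
        Finset.sum_le_sum fun i _ => hnorm i
    _ = _ := by
        rw [← Finset.mul_sum, ← integral_finsetSum _ fun i _ => (hYim i).norm]
        simp only [← hsum]

lemma setIntegral_mul_regimeFactor {s t : ℝ≥0} (hZs : Measurable (Z s)) (hZt : Measurable (Z t))
    (z : ℂ) (c σ : Fin K → ℝ) {Y : Ω → ℂ}
    (hi : Integrable (fun x => Y x * regimeFactor W Z z c σ s t x) Q) (j : Fin K) :
    ∫ x in {x | Z t x = j}, Y x * regimeFactor W Z z c σ s t x ∂Q
      = ∑ i, ∫ x in {x | Z s x = i} ∩ {x | Z t x = j},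
        Y x * stepFactor W z (c i) (σ i) s t x ∂Q := by
  have hm : ∀ i, MeasurableSet ({x | Z s x = i} ∩ {x | Z t x = j}) := fun i =>
    (hZs (measurableSet_singleton i)).inter (hZt (measurableSet_singleton j))
  have hU : {x | Z t x = j} = ⋃ i, {x | Z s x = i} ∩ {x | Z t x = j} := by ext x; simp
  have hd : Pairwise (Function.onFun Disjoint fun i => {x | Z s x = i} ∩ {x | Z t x = j}) :=
    fun i k hik => Set.disjoint_left.2 fun x hx hx' => hik (hx.1.symm.trans hx'.1)
  have key := integral_iUnion_fintype hm hd fun i => hi.integrableOn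
  rw [← hU] at key
  rw [key]
  refine Finset.sum_congr rfl fun i _ => setIntegral_congr_fun (hm i) fun x hx => ?_
  simp only [regimeFactor, show Z s x = i from hx.1]

lemma exp_eulerSum_succ {a b : ℝ≥0} (hab : a ≤ b) (c σ : Fin K → ℝ) (m k : ℕ) (z : ℂ) (x : Ω) :
    Complex.exp (z * (eulerSum a b c σ Z W m (k + 1) x : ℂ))
      = Complex.exp (z * (eulerSum a b c σ Z W m k x : ℂ))
        * regimeFactor W Z z c σ (grid a b m k) (grid a b m (k + 1)) x := by
  rw [regimeFactor, stepFactor, ← Complex.exp_add, eulerSum, Finset.sum_range_succ,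
    grid_succ_sub hab, ← eulerSum]
  push_cast
  ring_nf

/-- The weight `Y exp (z X)` carried along the Euler scheme stays adapted and integrable, and its
first absolute moment grows by a factor that does not depend on the mesh or on `Y`. -/
lemma exists_integral_norm_mul_exp_eulerSum_le (hZ : IsMarkovChain F Q τ A Z)
    (hW : IsBrownianRel F Q W) {a b : ℝ≥0} (hab : a ≤ b) (hb : b ≤ τ (Fin.last N)) (z : ℂ)
    (c σ : Fin K → ℝ) : ∃ R : ℝ, 0 ≤ R ∧ ∀ Y : Ω → ℂ, Measurable[F a] Y → Integrable Y Q →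
      ∀ {m k : ℕ}, k ≤ m → Measurable[F (grid a b m k)]
        (fun x => Y x * Complex.exp (z * (eulerSum a b c σ Z W m k x : ℂ))) ∧
      Integrable (fun x => Y x * Complex.exp (z * (eulerSum a b c σ Z W m k x : ℂ))) Q ∧
      ∫ x, ‖Y x * Complex.exp (z * (eulerSum a b c σ Z W m k x : ℂ))‖ ∂Q
        ≤ R * ∫ x, ‖Y x‖ ∂Q := by
  set Γ := ∑ k, |z.re * c k + z.re ^ 2 * σ k ^ 2 / 2| with hΓdef
  have hΓ0 : 0 ≤ Γ := by positivity
  have hΓ : ∀ k, z.re * c k + z.re ^ 2 * σ k ^ 2 / 2 ≤ Γ := fun k =>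
    (le_abs_self _).trans (Finset.single_le_sum
      (f := fun k => |z.re * c k + z.re ^ 2 * σ k ^ 2 / 2|) (fun _ _ => abs_nonneg _)
      (Finset.mem_univ k))
  have hab0 : (0 : ℝ) ≤ (b : ℝ) - a := sub_nonneg.2 (by exact_mod_cast hab)
  refine ⟨Real.exp (((b : ℝ) - a) * Γ), (Real.exp_pos _).le, fun Y hY hYi m k hk => ?_⟩
  have hmeas : ∀ k ≤ m, Measurable[F (grid a b m k)]
      (fun x => Y x * Complex.exp (z * (eulerSum a b c σ Z W m k x : ℂ))) := fun k hk =>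
    (hY.mono (F.mono (le_grid a b m k)) le_rfl).mul (Complex.measurable_exp.comp
      ((Complex.measurable_ofReal.comp (measurable_eulerSum hZ hW hab hb c σ hk)).const_mul z))
  have hk' : ∀ k ≤ m,
      Integrable (fun x => Y x * Complex.exp (z * (eulerSum a b c σ Z W m k x : ℂ))) Q ∧
      ∫ x, ‖Y x * Complex.exp (z * (eulerSum a b c σ Z W m k x : ℂ))‖ ∂Q
        ≤ Real.exp (k * (((b : ℝ) - a) / m) * Γ) * ∫ x, ‖Y x‖ ∂Q := by
    intro k hk
    induction k with
    | zero => simpa [eulerSum] using hYi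
    | succ k ih =>
      obtain ⟨h1, h2⟩ := ih (by lia)
      have hle := grid_mono a b m (Nat.le_succ k)
      have hZk := hZ.adapted (grid a b m k) ((grid_le hab (by lia)).trans hb)
      simp only [exp_eulerSum_succ hab, ← mul_assoc]
      refine ⟨integrable_mul_regimeFactor hW hle hZk z c σ (hmeas k (by lia)) h1,
        (integral_norm_mul_regimeFactor_le hW hle hZk z c σ hΓ (hmeas k (by lia)) h1).trans ?_⟩
      rw [Nat.succ_eq_add_one, grid_succ_sub hab]
      refine (mul_le_mul_of_nonneg_left h2 (Real.exp_pos _).le).trans_eq ?_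
      rw [← mul_assoc, ← Real.exp_add]
      push_cast
      ring_nf
  refine ⟨hmeas k hk, (hk' k hk).1, (hk' k hk).2.trans (mul_le_mul_of_nonneg_right
    (Real.exp_le_exp.2 (mul_le_mul_of_nonneg_right ?_ hΓ0))
    (integral_nonneg fun _ => norm_nonneg _))⟩
  rcases eq_or_ne (m : ℝ) 0 with h | h
  · rw [h, div_zero, mul_zero]; exact hab0
  · calc (k : ℝ) * (((b : ℝ) - a) / m) ≤ m * (((b : ℝ) - a) / m) := by gcongr
      _ = _ := mul_div_cancel₀ _ h

/-- Over one period, the vector `j ↦ 𝔼[Y exp (z X); Z = j]` computed from the Euler scheme evolves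
by the matrix exponential of the perturbed generator, up to an error that vanishes with the mesh,
uniformly in the initial weight `Y`. -/
theorem IsMarkovChain.setIntegral_period [IsProbabilityMeasure Q] (hZ : IsMarkovChain F Q τ A Z)
    (hτ : Monotone τ) (hW : IsBrownianRel F Q W) (n : Fin N) (hA : IsGenerator (A n)) (z : ℂ)
    (c σ : Fin K → ℝ) {ε : ℝ} (hε : 0 < ε) :
    ∀ᶠ m in atTop, ∀ Y : Ω → ℂ, Measurable[F (τ n.castSucc)] Y → Integrable Y Q → ∀ j,
      ‖∫ x in {x | Z (τ n.succ) x = j}, Y x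
          * Complex.exp (z * (eulerSum (τ n.castSucc) (τ n.succ) c σ Z W m m x : ℂ)) ∂Q
        - Matrix.vecMul (fun i => ∫ x in {x | Z (τ n.castSucc) x = i}, Y x ∂Q)
          (NormedSpace.exp (((τ n.succ : ℝ) - τ n.castSucc)
            • perturbedGenerator (A n) (fun k => gaussExponent z (c k) (σ k)))) j‖
        ≤ ε * ∫ x, ‖Y x‖ ∂Q := by
  set M := perturbedGenerator (A n) (fun k => gaussExponent z (c k) (σ k)) with hM
  have hstep := fun {ε : ℝ} (hε : 0 < ε) => hZ.setIntegral_step hτ hW n hA z c σ hε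
  set a := τ n.castSucc with ha
  set b := τ n.succ with hb
  have hab : a ≤ b := hτ (Fin.castSucc_le_succ n)
  have hbT : b ≤ τ (Fin.last N) := hτ (Fin.le_last _)
  have hab0 : (0 : ℝ) ≤ (b : ℝ) - a := sub_nonneg.2 (by exact_mod_cast hab)
  obtain ⟨D, hD0, hD⟩ := exists_norm_exp_smul_apply_le M ((b : ℝ) - a)
  obtain ⟨R, hR0, hYk⟩ := exists_integral_norm_mul_exp_eulerSum_le hZ hW hab hbT z c σ
  -- the accumulated error is at most `(K² R D (b - a)) ε₁` times the initial moment
  set ε₁ := ε / (K * K * R * D * ((b : ℝ) - a) + 1) with hε₁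
  have hε₁0 : 0 < ε₁ := by positivity
  obtain ⟨δ, hδ0, hδ⟩ := hstep hε₁0
  have hlim0 : Tendsto (fun m : ℕ => ((b : ℝ) - a) / m) atTop (𝓝 0) :=
    tendsto_const_div_atTop_nhds_zero_nat _
  filter_upwards [hlim0.eventually_lt_const hδ0, eventually_ne_atTop 0] with m hm hm0 Y hY hYi j
  have hmR : (m : ℝ) ≠ 0 := by exact_mod_cast hm0
  set h := ((b : ℝ) - a) / m with hh
  have hh0 : 0 ≤ h := by positivity
  have hmh : (m : ℝ) * h = (b : ℝ) - a := by rw [hh]; field_simp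
  set I := ∫ x, ‖Y x‖ ∂Q with hI
  have hI0 : 0 ≤ I := integral_nonneg fun _ => norm_nonneg _
  let Yk : ℕ → Ω → ℂ := fun k x => Y x * Complex.exp (z * (eulerSum a b c σ Z W m k x : ℂ))
  let v : ℕ → Fin K → ℂ := fun k j => ∫ x in {x | Z (grid a b m k) x = j}, Yk k x ∂Q
  have hv : ∀ k < m, ∀ j, ‖v (k + 1) j - Matrix.vecMul (v k) (NormedSpace.exp (h • M)) j‖
      ≤ K * (ε₁ * h * (R * I)) := by
    intro k hk j
    obtain ⟨h1, h2, h3⟩ := hYk Y hY hYi hk.le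
    have hle := grid_mono a b m (Nat.le_succ k)
    have hkT := (grid_le hab hk.le).trans hbT
    have hkT' := (grid_le hab (Nat.succ_le_of_lt hk)).trans hbT
    have hnext := setIntegral_mul_regimeFactor (hZ.measurable hkT) (hZ.measurable hkT') z c σ
      (integrable_mul_regimeFactor hW hle (hZ.adapted _ hkT) z c σ h1 h2) j
    have hv1 : v (k + 1) j = ∫ x in {x | Z (grid a b m (k + 1)) x = j},
        Yk k x * regimeFactor W Z z c σ (grid a b m k) (grid a b m (k + 1)) x ∂Q := by
      simp only [v, Yk, exp_eulerSum_succ hab, mul_assoc]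
    have hloc := hδ (grid a b m k) (grid a b m (k + 1)) (le_grid _ _ _ _) hle
      (grid_le hab hk) (by rw [grid_succ_sub hab]; exact hm) (Yk k) h1 h2
    rw [hv1, hnext]
    have hvec : Matrix.vecMul (v k) (NormedSpace.exp (h • M)) j
        = ∑ i, NormedSpace.exp (h • M) i j * v k i := by
      simp only [Matrix.vecMul, dotProduct, mul_comm]
    rw [hvec, ← Finset.sum_sub_distrib]
    calc _ ≤ ∑ i : Fin K, ε₁ * h * (R * I) := by
          refine norm_sum_le_of_le _ fun i _ => ?_
          have := hloc i j
          rw [grid_succ_sub hab] at this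
          exact this.trans (mul_le_mul_of_nonneg_left h3 (by positivity))
      _ = _ := by rw [Finset.sum_const, Finset.card_univ, Fintype.card_fin, nsmul_eq_mul]
  have hfin := norm_sub_vecMul_exp_le M (D := D) hh0 (by rw [hmh]; exact hD) hv j
  have hv0 : v 0 = fun i => ∫ x in {x | Z a x = i}, Y x ∂Q := by
    ext i
    simp [v, Yk, grid_zero, eulerSum]
  have hvm : v m j = ∫ x in {x | Z b x = j}, Yk m x ∂Q := by
    simp only [v, grid_self hab hm0]
  rw [hv0, hvm, hmh] at hfin
  refine hfin.trans ?_
  have e : (m : ℝ) * (K * (K * (ε₁ * h * (R * I)) * D))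
      = (K * K * R * D * ((b : ℝ) - a)) * ε₁ * I := by rw [← hmh]; ring
  rw [e]
  refine mul_le_mul_of_nonneg_right ?_ hI0
  rw [hε₁, mul_div_assoc', div_le_iff₀ (by positivity)]
  nlinarith

end Period

/-! ### Passing to the limit and chaining the periods -/

section Limit

variable {Ω : Type*} {mΩ : MeasurableSpace Ω} {Q : Measure Ω}

/-- A Lipschitz bound for `x ↦ exp (z x)` on the real line. -/
lemma norm_exp_mul_sub_exp_mul_le (z : ℂ) (x y : ℝ) :
    ‖Complex.exp (z * x) - Complex.exp (z * y)‖
      ≤ |x - y| * (‖z‖ * (‖Complex.exp (z * x)‖ + ‖Complex.exp (z * y)‖)) := by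
  have hd : ∀ t : ℝ, HasDerivAt (fun t : ℝ => Complex.exp (z * t)) (Complex.exp (z * t) * z) t := by
    intro t
    have h1 : HasDerivAt (fun t : ℝ => z * (t : ℂ)) (z * 1) t :=
      (Complex.ofRealCLM.hasDerivAt (x := t)).const_mul z
    simpa using h1.cexp
  have hb : ∀ t ∈ Set.uIcc y x, ‖Complex.exp (z * t) * z‖
      ≤ ‖z‖ * (‖Complex.exp (z * x)‖ + ‖Complex.exp (z * y)‖) := by
    intro t ht
    rw [norm_mul, mul_comm]
    refine mul_le_mul_of_nonneg_left ?_ (norm_nonneg _)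
    simp only [Complex.norm_exp, Complex.re_mul_ofReal]
    have hx := Real.exp_pos (z.re * x)
    have hy := Real.exp_pos (z.re * y)
    have hmax : z.re * t ≤ max (z.re * x) (z.re * y) := by
      rcases Set.mem_uIcc.1 ht with h | h <;> rcases le_total 0 z.re with hz | hz
      · exact le_max_of_le_left (mul_le_mul_of_nonneg_left h.2 hz)
      · exact le_max_of_le_right (mul_le_mul_of_nonpos_left h.1 hz)
      · exact le_max_of_le_right (mul_le_mul_of_nonneg_left h.2 hz)
      · exact le_max_of_le_left (mul_le_mul_of_nonpos_left h.1 hz)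
    rcases le_max_iff.1 hmax with h | h
    · linarith [Real.exp_le_exp.2 h]
    · linarith [Real.exp_le_exp.2 h]
  have := (convex_uIcc y x).norm_image_sub_le_of_norm_hasDerivWithin_le
    (fun t _ => (hd t).hasDerivWithinAt) hb Set.left_mem_uIcc Set.right_mem_uIcc
  rwa [Real.norm_eq_abs, mul_comm _ |x - y|] at this

lemma measurable_cexp_mul_ofReal (z : ℂ) : Measurable fun r : ℝ => Complex.exp (z * r) :=
  Complex.measurable_exp.comp (Complex.measurable_ofReal.const_mul z)

/-- A uniform bound on exponential moments passes to an `L²` limit. -/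
lemma lintegral_enorm_exp_le_of_tendsto {Xm : ℕ → Ω → ℝ} {X : Ω → ℝ} {z : ℂ} {B : ℝ≥0∞}
    (hXm : ∀ m, AEStronglyMeasurable (Xm m) Q) (hX : AEStronglyMeasurable X Q)
    (hlim : Tendsto (fun m => eLpNorm (Xm m - X) 2 Q) atTop (𝓝 0))
    (hB : ∀ m, ∫⁻ x, ‖Complex.exp (z * Xm m x)‖ₑ ∂Q ≤ B) :
    ∫⁻ x, ‖Complex.exp (z * X x)‖ₑ ∂Q ≤ B := by
  obtain ⟨ns, -, hns⟩ := (tendstoInMeasure_of_tendsto_eLpNorm two_ne_zero hXm hX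
    hlim).exists_seq_tendsto_ae
  have hm : ∀ m, AEMeasurable (fun x => ‖Complex.exp (z * Xm m x)‖ₑ) Q := fun m =>
    ((measurable_cexp_mul_ofReal z).comp_aemeasurable (hXm m).aemeasurable).enorm
  calc ∫⁻ x, ‖Complex.exp (z * X x)‖ₑ ∂Q
      = ∫⁻ x, liminf (fun i => ‖Complex.exp (z * Xm (ns i) x)‖ₑ) atTop ∂Q := by
        refine lintegral_congr_ae ?_
        filter_upwards [hns] with x hx
        have hc : Continuous fun r : ℝ => ‖Complex.exp (z * r)‖ₑ := by fun_prop
        exact ((hc.tendsto _).comp hx).liminf_eq.symm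
    _ ≤ liminf (fun i => ∫⁻ x, ‖Complex.exp (z * Xm (ns i) x)‖ₑ ∂Q) atTop :=
        lintegral_liminf_le' fun i => hm _
    _ ≤ B := by
        refine liminf_le_of_le ?_ fun b hb => ?_
        · isBoundedDefault
        · obtain ⟨i, hi⟩ := hb.exists
          exact hi.trans (hB _)

/-- Exponential moments converge along an `L²`-convergent sequence whose exponential moments of all
orders are bounded. -/
theorem tendsto_integral_exp [IsFiniteMeasure Q] {Xm : ℕ → Ω → ℝ} {X : Ω → ℝ}
    (hXm : ∀ m, Measurable (Xm m)) (hX : AEStronglyMeasurable X Q)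
    (hlim : Tendsto (fun m => eLpNorm (Xm m - X) 2 Q) atTop (𝓝 0))
    (hB : ∀ z : ℂ, ∃ B : ℝ, ∀ m, Integrable (fun x => Complex.exp (z * Xm m x)) Q ∧
      ∫ x, ‖Complex.exp (z * Xm m x)‖ ∂Q ≤ B) (z : ℂ) :
    Integrable (fun x => Complex.exp (z * X x)) Q ∧
    Tendsto (fun m => ∫ x, Complex.exp (z * Xm m x) ∂Q) atTop
      (𝓝 (∫ x, Complex.exp (z * X x) ∂Q)) := by
  have hXm' : ∀ m, AEStronglyMeasurable (Xm m) Q := fun m => (hXm m).aestronglyMeasurable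
  have hB' : ∀ w : ℂ, ∃ B : ℝ, (∀ m, ∫⁻ x, ‖Complex.exp (w * Xm m x)‖ₑ ∂Q ≤ ENNReal.ofReal B) ∧
      ∫⁻ x, ‖Complex.exp (w * X x)‖ₑ ∂Q ≤ ENNReal.ofReal B := by
    intro w
    obtain ⟨B, hB⟩ := hB w
    have h1 : ∀ m, ∫⁻ x, ‖Complex.exp (w * Xm m x)‖ₑ ∂Q ≤ ENNReal.ofReal B := fun m => by
      rw [← ofReal_integral_norm_eq_lintegral_enorm (hB m).1]
      exact ENNReal.ofReal_le_ofReal (hB m).2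
    exact ⟨B, h1, lintegral_enorm_exp_le_of_tendsto hXm' hX hlim h1⟩
  have hEm : ∀ {V : Ω → ℝ} (w : ℂ), AEStronglyMeasurable V Q →
      AEStronglyMeasurable (fun x => Complex.exp (w * V x)) Q := fun w hV =>
    ((measurable_cexp_mul_ofReal w).comp_aemeasurable hV.aemeasurable).aestronglyMeasurable
  have hint : Integrable (fun x => Complex.exp (z * X x)) Q := by
    obtain ⟨B, -, hBX⟩ := hB' z
    exact ⟨hEm z hX, hBX.trans_lt ENNReal.ofReal_lt_top⟩
  refine ⟨hint, ?_⟩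
  obtain ⟨B, hB2, hBX2⟩ := hB' (2 * z)
  -- the second moment of `exp (z V)` is the first absolute moment of `exp (2 z V)`
  have hsq : ∀ V : Ω → ℝ, ∫⁻ x, ‖Complex.exp (2 * z * V x)‖ₑ ∂Q ≤ ENNReal.ofReal B →
      eLpNorm (fun x => ‖Complex.exp (z * V x)‖) 2 Q ≤ ENNReal.ofReal B ^ (2 : ℝ)⁻¹ := by
    intro V hV
    rw [eLpNorm_two_eq_lintegral]
    refine ENNReal.rpow_le_rpow (le_trans (lintegral_mono fun x => ?_) hV) (by simp)
    rw [← ofReal_norm]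
    refine ENNReal.ofReal_le_ofReal (le_of_eq ?_)
    rw [← norm_pow, ← Complex.exp_nat_mul]
    congr 2
    push_cast
    ring
  refine tendsto_integral_of_L1 _ hint.1 (Eventually.of_forall fun m => ((hB z).choose_spec m).1) ?_
  have hle : ∀ m, ∫⁻ x, ‖Complex.exp (z * Xm m x) - Complex.exp (z * X x)‖ₑ ∂Q
      ≤ eLpNorm (Xm m - X) 2 Q * (‖z‖ₑ * (ENNReal.ofReal B ^ (2 : ℝ)⁻¹
        + ENNReal.ofReal B ^ (2 : ℝ)⁻¹)) := by
    intro m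
    let g : Ω → ℝ := fun x => ‖z‖ * (‖Complex.exp (z * Xm m x)‖ + ‖Complex.exp (z * X x)‖)
    have hgm : AEStronglyMeasurable g Q :=
      ((hEm z (hXm' m)).norm.add (hEm z hX).norm).const_mul ‖z‖
    calc _ ≤ ∫⁻ x, ‖((Xm m - X) • g) x‖ₑ ∂Q := by
          refine lintegral_mono fun x => ?_
          rw [← ofReal_norm, ← ofReal_norm]
          refine ENNReal.ofReal_le_ofReal ((norm_exp_mul_sub_exp_mul_le z _ _).trans_eq ?_)
          simp only [g, Pi.smul_apply', Pi.sub_apply, smul_eq_mul, norm_mul, Real.norm_eq_abs,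
            abs_norm]
          rw [abs_of_nonneg (by positivity :
            0 ≤ ‖Complex.exp (z * Xm m x)‖ + ‖Complex.exp (z * X x)‖)]
      _ = eLpNorm ((Xm m - X) • g) 1 Q := eLpNorm_one_eq_lintegral_enorm.symm
      _ ≤ eLpNorm (Xm m - X) 2 Q * eLpNorm g 2 Q :=
          eLpNorm_smul_le_mul_eLpNorm hgm ((hXm' m).sub hX)
      _ ≤ _ := by
          gcongr
          have hg : g = ‖z‖ • ((fun x => ‖Complex.exp (z * Xm m x)‖)
              + fun x => ‖Complex.exp (z * X x)‖) := rfl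
          rw [hg, eLpNorm_const_smul, enorm_norm]
          gcongr
          exact (eLpNorm_add_le (hEm z (hXm' m)).norm (hEm z hX).norm one_le_two).trans
            (add_le_add (hsq _ (hB2 m)) (hsq _ hBX2))
  refine tendsto_of_tendsto_of_tendsto_of_le_of_le tendsto_const_nhds ?_ (fun _ => bot_le) hle
  have := ENNReal.Tendsto.mul_const hlim (b := ‖z‖ₑ * (ENNReal.ofReal B ^ (2 : ℝ)⁻¹
        + ENNReal.ofReal B ^ (2 : ℝ)⁻¹)) (Or.inr ?_)
  · rwa [zero_mul] at this
  · refine ENNReal.mul_ne_top enorm_ne_top (ENNReal.add_ne_top.2 ⟨?_, ?_⟩) <;>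
    exact ENNReal.rpow_ne_top_of_nonneg (by simp) ENNReal.ofReal_ne_top

end Limit

section Chain

variable {Ω : Type*} {mΩ : MeasurableSpace Ω} {Q : Measure Ω} {F : Filtration ℝ≥0 mΩ}
  {W X : ℝ≥0 → Ω → ℝ} {N K : ℕ} {τ : Fin (N + 1) → ℝ≥0} {A : Fin N → Matrix (Fin K) (Fin K) ℝ}
  {μ σ : Fin N → Fin K → ℝ} {Z : ℝ≥0 → Ω → Fin K}

/-- The drift rates `μ - σ² / 2` of the log-return. -/
noncomputable def logDrift (μ σ : Fin K → ℝ) (k : Fin K) : ℝ := μ k - 1 / 2 * σ k ^ 2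

lemma Psi_eq_perturbedGenerator (A : Matrix (Fin K) (Fin K) ℝ) (μ σ : Fin K → ℝ) (ω : ℂ) :
    Psi A μ σ ω = perturbedGenerator A
      (fun k => gaussExponent (Complex.I * ω) (logDrift μ σ k) (σ k)) := by
  ext j k
  simp only [Psi, perturbedGenerator, Matrix.of_apply, Matrix.add_apply, Matrix.map_apply,
    Matrix.diagonal_apply]
  split_ifs with h
  · subst h
    simp only [gaussExponent, logDrift, mul_pow, Complex.I_sq]
    push_cast
    ring
  · simp

/-- The propagator `exp ((τ_{n+1} - τ_n) Ψ)` of one period, written for a general exponent `z`;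
`z = i ω` gives the matrix `Psi`. -/
noncomputable def periodPropagator (τ : Fin (N + 1) → ℝ≥0) (A : Fin N → Matrix (Fin K) (Fin K) ℝ)
    (μ σ : Fin N → Fin K → ℝ) (z : ℂ) (n : Fin N) : Matrix (Fin K) (Fin K) ℂ :=
  NormedSpace.exp (((τ n.succ : ℝ) - τ n.castSucc) • perturbedGenerator (A n)
    (fun k => gaussExponent z (logDrift (μ n) (σ n) k) (σ n k)))

/-- At the end of every period, the log-return is the `L²` limit of adapted Euler approximations
with bounded exponential moments, whose transforms on the events `{Z = j}` converge to the product
of the propagators of the elapsed periods. -/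
theorem exists_approximation [IsProbabilityMeasure Q] (hτ : Monotone τ) (hτ0 : τ 0 = 0)
    (hA : ∀ n, IsGenerator (A n)) (hZ : IsMarkovChain F Q τ A Z) (hW : IsBrownianRel F Q W)
    (hX : IsLogReturn F Q τ μ σ Z W X) (n : Fin (N + 1)) :
    AEStronglyMeasurable (X (τ n)) Q ∧ ∃ Xm : ℕ → Ω → ℝ, (∀ m, Measurable[F (τ n)] (Xm m)) ∧
      Tendsto (fun m => eLpNorm (Xm m - X (τ n)) 2 Q) atTop (𝓝 0) ∧
      (∀ z : ℂ, ∃ B : ℝ, ∀ m, Integrable (fun x => Complex.exp (z * Xm m x)) Q ∧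
        ∫ x, ‖Complex.exp (z * Xm m x)‖ ∂Q ≤ B) ∧
      ∀ z j, Tendsto (fun m => ∫ x in {x | Z (τ n) x = j}, Complex.exp (z * Xm m x) ∂Q) atTop
        (𝓝 (Matrix.vecMul (fun k => (Q.real {x | Z 0 x = k} : ℂ))
          ((List.ofFn (periodPropagator τ A μ σ z)).take n).prod j)) := by
  induction n using Fin.induction with
  | zero =>
    have h0 : X (τ 0) =ᵐ[Q] 0 := by rw [hτ0]; exact hX.init
    refine ⟨(aestronglyMeasurable_const (b := (0 : ℝ))).congr h0.symm, fun _ _ => 0,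
      fun _ => measurable_const, ?_, fun z => ⟨1, fun m => ?_⟩, fun z j => ?_⟩
    · have : eLpNorm ((fun _ => (0 : ℝ)) - X (τ 0)) 2 Q = 0 := by
        rw [eLpNorm_congr_ae (g := 0), eLpNorm_zero]
        filter_upwards [h0] with x hx
        simp [hx]
      simp only [this]
      exact tendsto_const_nhds
    · simp
    · simp [hτ0]
  | succ n ih =>
    obtain ⟨hXm, Xm, hmeas, hlim, hmom, hval⟩ := ih
    have hle : τ n.castSucc ≤ τ n.succ := hτ (Fin.castSucc_le_succ n)
    have hT : τ n.succ ≤ τ (Fin.last N) := hτ (Fin.le_last _)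
    obtain ⟨J, hJ, hXJ⟩ := hX.sde n (τ n.succ) hle le_rfl
    obtain ⟨hE, hDm⟩ := tendsto_eulerSum hZ hτ hW n (logDrift (μ n) (σ n)) (σ n) hJ
    let D : Ω → ℝ := fun x => (∫ s in (τ n.castSucc : ℝ)..(τ n.succ),
      logDrift (μ n) (σ n) (Z s.toNNReal x)) + J x
    let E : ℕ → Ω → ℝ := fun m =>
      eulerSum (τ n.castSucc) (τ n.succ) (logDrift (μ n) (σ n)) (σ n) Z W m m
    have hXD : X (τ n.succ) =ᵐ[Q] X (τ n.castSucc) + D := by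
      filter_upwards [hXJ] with x hx
      rw [hx, Pi.add_apply, add_assoc]
      rfl
    have hEm : ∀ m, Measurable[F (τ n.succ)] (E m) := fun m =>
      (measurable_eulerSum hZ hW hle hT _ _ le_rfl).mono (F.mono (grid_le hle le_rfl)) le_rfl
    have hEm' : ∀ m, AEStronglyMeasurable (E m) Q := fun m =>
      ((hEm m).mono (F.le _) le_rfl).aestronglyMeasurable
    have hXmm' : ∀ m, AEStronglyMeasurable (Xm m) Q := fun m =>
      ((hmeas m).mono (F.le _) le_rfl).aestronglyMeasurable
    have hYm : ∀ (z : ℂ) m, Measurable[F (τ n.castSucc)] fun x => Complex.exp (z * Xm m x) :=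
      fun z m => (measurable_cexp_mul_ofReal z).comp (hmeas m)
    have hexp : ∀ (z : ℂ) m x, Complex.exp (z * ((Xm m + E m) x : ℝ))
        = Complex.exp (z * Xm m x) * Complex.exp (z * E m x) := by
      intro z m x
      rw [← Complex.exp_add, Pi.add_apply]
      push_cast
      ring_nf
    refine ⟨(hXm.add hDm).congr hXD.symm, fun m => Xm m + E m,
      fun m => ((hmeas m).mono (F.mono hle) le_rfl).add (hEm m), ?_, fun z => ?_, fun z j => ?_⟩
    · have h1 : ∀ m, eLpNorm (Xm m + E m - X (τ n.succ)) 2 Q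
          ≤ eLpNorm (Xm m - X (τ n.castSucc)) 2 Q + eLpNorm (E m - D) 2 Q := by
        intro m
        have e : (Xm m + E m - X (τ n.succ) : Ω → ℝ)
            =ᵐ[Q] (Xm m - X (τ n.castSucc)) + (E m - D) := by
          filter_upwards [hXD] with x hx
          simp only [Pi.add_apply, Pi.sub_apply] at hx ⊢
          rw [hx]
          ring
        rw [eLpNorm_congr_ae e]
        exact eLpNorm_add_le ((hXmm' m).sub hXm) ((hEm' m).sub hDm) one_le_two
      have h2 := hlim.add hE
      rw [add_zero] at h2
      exact tendsto_of_tendsto_of_tendsto_of_le_of_le tendsto_const_nhds h2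
        (fun _ => bot_le) h1
    · obtain ⟨B, hB⟩ := hmom z
      obtain ⟨R, hR0, hR⟩ := exists_integral_norm_mul_exp_eulerSum_le hZ hW hle hT z
        (logDrift (μ n) (σ n)) (σ n)
      refine ⟨R * B, fun m => ?_⟩
      obtain ⟨-, h1, h2⟩ := hR _ (hYm z m) (hB m).1 (le_refl m)
      simp only [hexp]
      exact ⟨h1, h2.trans (mul_le_mul_of_nonneg_left (hB m).2 hR0)⟩
    · obtain ⟨B, hB⟩ := hmom z
      set P := periodPropagator τ A μ σ z n with hP
      set v : Fin K → ℂ := Matrix.vecMul (fun k => (Q.real {x | Z 0 x = k} : ℂ))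
          ((List.ofFn (periodPropagator τ A μ σ z)).take n).prod with hv
      have htake : ((List.ofFn (periodPropagator τ A μ σ z)).take (n.succ : ℕ)).prod
          = ((List.ofFn (periodPropagator τ A μ σ z)).take n).prod * P := by
        rw [Fin.val_succ, List.prod_take_succ _ _ (by simp), List.getElem_ofFn]
      rw [htake, ← Matrix.vecMul_vecMul, ← hv]
      let w : ℕ → Fin K → ℂ := fun m i =>
        ∫ x in {x | Z (τ n.castSucc) x = i}, Complex.exp (z * Xm m x) ∂Q
      have hw : Tendsto (fun m => Matrix.vecMul (w m) P j) atTop (𝓝 (Matrix.vecMul v P j)) := by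
        simp only [Matrix.vecMul, dotProduct]
        exact tendsto_finsetSum _ fun i _ =>
          (show Tendsto (fun m => w m i) atTop (𝓝 (v i)) from hval z i).mul_const _
      have hB0 : 0 ≤ B := (integral_nonneg fun _ => norm_nonneg _).trans (hB 0).2
      have hdiff : Tendsto (fun m => ∫ x in {x | Z (τ n.succ) x = j},
          Complex.exp (z * ((Xm m + E m) x : ℝ)) ∂Q - Matrix.vecMul (w m) P j) atTop (𝓝 0) := by
        rw [Metric.tendsto_atTop']
        intro ε hε
        have hε' : 0 < ε / (B + 1) := by positivity
        obtain ⟨m₀, hm₀⟩ := eventually_atTop.1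
          (hZ.setIntegral_period hτ hW n (hA n) z (logDrift (μ n) (σ n)) (σ n) hε')
        refine ⟨m₀, fun m hm => ?_⟩
        have := hm₀ m hm.le _ (hYm z m) (hB m).1 j
        rw [dist_zero_right]
        simp only [hexp]
        refine this.trans_lt ?_
        calc ε / (B + 1) * ∫ x, ‖Complex.exp (z * Xm m x)‖ ∂Q ≤ ε / (B + 1) * B := by
              gcongr; exact (hB m).2
          _ < ε := by
              rw [div_mul_eq_mul_div, div_lt_iff₀ (by positivity)]
              nlinarith
      simpa using hdiff.add hw

end Chain

end RegimeSwitching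

theorem proposition1 {Ω : Type*} {mΩ : MeasurableSpace Ω} (Q : Measure Ω) [IsProbabilityMeasure Q]
    (F : Filtration ℝ≥0 mΩ) {N K : ℕ}
    (τ : Fin (N + 1) → ℝ≥0) (hτ : StrictMono τ) (hτ0 : τ 0 = 0)
    (A : Fin N → Matrix (Fin K) (Fin K) ℝ) (hA : ∀ n, RegimeSwitching.IsGenerator (A n))
    (μ σ : Fin N → Fin K → ℝ) (hσ : ∀ n k, 0 ≤ σ n k)
    (Z : ℝ≥0 → Ω → Fin K) (hZ : RegimeSwitching.IsMarkovChain F Q τ A Z)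
    (W : ℝ≥0 → Ω → ℝ) (hW : RegimeSwitching.IsBrownianRel F Q W)
    (X : ℝ≥0 → Ω → ℝ) (hX : RegimeSwitching.IsLogReturn F Q τ μ σ Z W X) (ω : ℂ) :
    Integrable (fun x => Complex.exp (Complex.I * ω * (X (τ (Fin.last N)) x : ℂ))) Q ∧
    ∫ x, Complex.exp (Complex.I * ω * (X (τ (Fin.last N)) x : ℂ)) ∂Q =
      (fun k : Fin K => (Q.real {x | Z 0 x = k} : ℂ)) ⬝ᵥ
        Matrix.mulVec
          (List.ofFn fun n : Fin N =>
            NormedSpace.exp (((τ n.succ : ℝ) - (τ n.castSucc : ℝ)) •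
              RegimeSwitching.Psi (A n) (μ n) (σ n) ω)).prod
          (fun _ => 1) := by
  obtain ⟨hXm, Xm, hmeas, hlim, hmom, hval⟩ := RegimeSwitching.exists_approximation hτ.monotone hτ0
    hA hZ hW hX (Fin.last N)
  obtain ⟨hint, hconv⟩ := RegimeSwitching.tendsto_integral_exp
    (fun m => (hmeas m).mono (F.le _) le_rfl) hXm hlim hmom (Complex.I * ω)
  refine ⟨hint, tendsto_nhds_unique hconv ?_⟩
  simp only [RegimeSwitching.Psi_eq_perturbedGenerator]
  have hsum := tendsto_finsetSum Finset.univ fun j (_ : j ∈ Finset.univ) =>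
    hval (Complex.I * ω) j
  have htake : (List.ofFn (RegimeSwitching.periodPropagator τ A μ σ (Complex.I * ω))).take
      (Fin.last N : ℕ) = List.ofFn (RegimeSwitching.periodPropagator τ A μ σ (Complex.I * ω)) :=
    List.take_of_length_le (by simp)
  rw [htake] at hsum
  rw [Matrix.dotProduct_mulVec]
  simp only [dotProduct, mul_one]
  refine hsum.congr fun m => ?_
  obtain ⟨B, hB⟩ := hmom (Complex.I * ω)
  rw [← integral_iUnion_fintype (s := fun j => {x | Z (τ (Fin.last N)) x = j})
    (fun j => hZ.measurable le_rfl (measurableSet_singleton j)) ?_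
    (fun j => (hB m).1.integrableOn)]
  · rw [show (⋃ j, {x | Z (τ (Fin.last N)) x = j}) = Set.univ by ext x; simp, setIntegral_univ]
  · exact fun i j hij => Set.disjoint_left.2 fun x hx hx' => hij (hx.symm.trans hx')
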